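/- Let $\Gamma$ be a subgroup of finite index in $\mathrm{SL}_2(\mathbb Z)$ and let $f$ be a cusp form of real weight $r>2$ for $\Gamma$ with a unimodular multiplier system $\{\mu_\gamma\}$: $f$ is holomorphic on the upper half-plane $\mathbb H$, $f(\gamma z)=\mu_\gamma (cz+d)^r f(z)$ with $|\mu_\gamma|=1$ for all $\gamma=\left(\begin{smallmatrix}a&b\\c&d\end{smallmatrix}\right)\in\Gamma$, $f$ has at most polynomial growth as $\operatorname{Im} z\to0^+$, and $f$ is cuspidal at every cusp in $\mathbb Q\cup\{\infty\}$ (see below). All powers and logarithms use $-\pi<\arg\le\pi$. The width of a cusp is the order of its stabilizer in $\mathrm{SL}_2(\mathbb Z)$ modulo $\Gamma$, with $\gamma$ and $-\gamma$ identified. A scaling matrix for a cusp $\mathfrak a$ of width $m_{\mathfrak a}$ is $\sigma=\gamma\left(\begin{smallmatrix}\sqrt{m_{\mathfrak a}}&0\\0&1/\sqrt{m_{\mathfrak a}}\end{smallmatrix}\right)$, where $\gamma\in\mathrm{SL}_2(\mathbb Z)$, $\gamma(\infty)=\mathfrak a$, and the bottom row $(c,d)$ of $\gamma$ has $c<0$,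 or $c=0$ and $d=1$. Put $f^\sigma(z)=f(\sigma z)/j_\sigma(z)^r$, where $j_\sigma(z)$ is the product of the bottom row of $\sigma$ with $(z,1)^T$, and write $f^\sigma(z)=\sum_{n\ge0}a_n^\sigma e^{2\pi i(n+\kappa_{\mathfrak a})z}$ with $0\le\kappa_{\mathfrak a}<1$; $f$ is cuspidal at $\mathfrak a$ if $\kappa_{\mathfrak a}>0$ or $a_0^\sigma=0$, and then $f(\mathfrak a)=0$. Let $m$ be the width of $\infty$ and write $f(mz)=\sum_{n\ge0}a_ne^{2\pi i(n+\kappa)z}$ with $0\le\kappa<1$. Let $\alpha=r-1$, let $x_0\in\mathbb Q$ and let $\sigma$ be any scaling matrix for $x_0$. Then the series $$f_\alpha(x)=\sum_{n+\kappa>0}\frac{a_n}{(n+\kappa)^\alpha}e^{2\pi i(n+\kappa)x/m},\qquad f^\sigma_\alpha(x)=\sum_{n+\kappa_{x_0}>0}\frac{a_n^\sigma}{(n+\kappa_{x_0})^\alpha}e^{2\pi i(n+\kappa_{x_0})x}$$ converge (as limits of partial sums) for every real $x$, and there are real constants $A\neq0$ and $B>0$ such that the error term $E$ in the approximate functional equation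 $$f_\alpha(x)=A\,i^{-\alpha}f(x_0)\,\psi(x-x_0)+B\,|x-x_0|^{2\alpha}(x-x_0)^{-r}f^\sigma_\alpha(\sigma^{-1}x)+E(x)\qquad(x\in\mathbb R)$$ is given for every $x\in\mathbb R$ by $$E(x)=\frac{(2\pi)^{r-1}}{(im)^{r-1}\,\Gamma(r-1)}\int_{(x_0)}(z-x)^{r-2}f(z)\,dz,$$ where $(x_0)$ is the vertical ray from $x_0$ to $i\infty$ and the integral converges absolutely. Here $\psi(x)=x^{\alpha-r}$ if $\alpha-r\notin\mathbb Z$ and $\psi(x)=x^{\alpha-r}\log x$ if $\alpha-r\in\mathbb Z$; the term with $A$ is zero since $f(x_0)=0$, and at $x=x_0$ the term with $B$ is read as its limit $0$. If moreover $r$ is an integer, then $E$ is a polynomial in $x$, of degree at most $r-2$ (the Eichler–Shimura period polynomial, up to a constant factor). -/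

import Mathlib

open scoped MatrixGroups

noncomputable section

namespace FracModular

open UpperHalfPlane Matrix MeasureTheory

/-- The automorphy factor `j_g(z) = c z + d` of a real unimodular matrix `g = (a, b; c, d)`. -/
def autFactor (g : SL(2, ℝ)) (z : ℍ) : ℂ :=
  ((g 1 0 : ℝ) : ℂ) * (z : ℂ) + ((g 1 1 : ℝ) : ℂ)

/-- The slash operator `f^g(z) = f(g z) / j_g(z) ^ r` for a matrix `g` of determinant one. The
power uses the branch of the argument in `(-π, π]`. -/
def slash (r : ℝ) (g : SL(2, ℝ)) (f : ℍ → ℂ) (z : ℍ) : ℂ :=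
  f (g • z) / autFactor g z ^ (r : ℂ)

/-- An integral matrix regarded as a real one. -/
def toReal (γ : SL(2, ℤ)) : SL(2, ℝ) := SpecialLinearGroup.map (Int.castRingHom ℝ) γ

/-- `f` is a modular form of real weight `r` for the group `Γ` and the multiplier system `mu`:
it is holomorphic on the upper half-plane, satisfies the transformation law with unimodular
multipliers, and has at most polynomial growth as the imaginary part tends to `0` from above. -/
structure IsModularForm (Γ : Subgroup SL(2, ℤ)) (r : ℝ) (mu : SL(2, ℤ) → ℂ) (f : ℍ → ℂ) :
    Prop where
  holo : DifferentiableOn ℂ (f ∘ ofComplex) {z : ℂ | 0 < z.im}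
  unimodular : ∀ γ ∈ Γ, ‖mu γ‖ = 1
  law : ∀ γ ∈ Γ, ∀ z : ℍ, f (γ • z) = mu γ * autFactor (toReal γ) z ^ (r : ℂ) * f z
  growth : ∃ C K δ : ℝ, 0 < δ ∧ ∀ z : ℍ, z.im < δ → ‖f z‖ ≤ C * z.im ^ (-K)

/-- The stabilizer in `SL(2, ℤ)` of a cusp, that is, of an element of `ℚ ∪ {∞}`. -/
def cuspStabilizer (𝔞 : OnePoint ℚ) : Subgroup SL(2, ℤ) :=
  (MulAction.stabilizer (GL (Fin 2) ℚ) 𝔞).comap (SpecialLinearGroup.mapGL ℚ)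

/-- The width of the cusp `𝔞` for `Γ`: the order of the stabilizer of `𝔞` modulo `Γ`, matrices
being identified with the Möbius transformations they induce (so `γ` and `-γ` are identified). -/
def cuspWidth (Γ : Subgroup SL(2, ℤ)) (𝔞 : OnePoint ℚ) : ℕ :=
  (Γ ⊔ Subgroup.zpowers (-1)).relIndex (cuspStabilizer 𝔞)

/-- `σ` is a scaling matrix for the cusp `𝔞`: `σ = γ η`, where `γ ∈ SL(2, ℤ)` sends `∞` to `𝔞`,
its bottom row `(c, d)` satisfies `c < 0`, or `c = 0` and `d = 1`, and
`η = (√m, 0; 0, 1 / √m)` with `m` the width of `𝔞`. -/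
def IsScalingMatrix (Γ : Subgroup SL(2, ℤ)) (𝔞 : OnePoint ℚ) (σ : SL(2, ℝ)) : Prop :=
  ∃ γ : SL(2, ℤ),
    SpecialLinearGroup.mapGL ℚ γ • (OnePoint.infty : OnePoint ℚ) = 𝔞 ∧
    (γ 1 0 < 0 ∨ (γ 1 0 = 0 ∧ γ 1 1 = 1)) ∧
    (σ : Matrix (Fin 2) (Fin 2) ℝ) = (toReal γ : Matrix (Fin 2) (Fin 2) ℝ) *
      !![√(cuspWidth Γ 𝔞 : ℝ), 0; 0, 1 / √(cuspWidth Γ 𝔞 : ℝ)]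

/-- The parameter `κ ∈ [0, 1)` of a function satisfying `g (z + 1) = exp (2 π i κ) g z`.
It is unique when `g` is not the zero function. -/
def cuspParam (g : ℍ → ℂ) : ℝ :=
  Classical.epsilon fun κ : ℝ => 0 ≤ κ ∧ κ < 1 ∧
    ∀ z : ℍ, g ((1 : ℝ) +ᵥ z) = Complex.exp (2 * Real.pi * Complex.I * κ) * g z

/-- The coefficient `a_n` in `g z = ∑ a_n exp (2 π i (n + κ) z)`, as the integral
`∫ g z exp (-2 π i (n + κ) z) dz` over the segment from `i` to `1 + i`. -/
def fourierCoef (g : ℍ → ℂ) (n : ℕ) : ℂ :=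
  ∫ x in (0 : ℝ)..1, g (ofComplex (x + Complex.I)) *
    Complex.exp (-(2 * Real.pi * Complex.I * (n + cuspParam g : ℝ) * (x + Complex.I)))

/-- The value at the cusp `∞` of a function with a Fourier expansion as above: zero when it is
cuspidal there, i.e. if `κ > 0` or `a_0 = 0`, and `a_0` otherwise. For `g = slash r σ f` with `σ` a
scaling matrix for `𝔞`, this is the value `f(𝔞)`. -/
def valueAtInfty (g : ℍ → ℂ) : ℂ := if 0 < cuspParam g then 0 else fourierCoef g 0

/-- A cusp form is a modular form that is cuspidal at every cusp `𝔞`, that is, whose expansion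
at `𝔞` has `κ > 0` or `a_0 = 0`. -/
structure IsCuspForm (Γ : Subgroup SL(2, ℤ)) (r : ℝ) (mu : SL(2, ℤ) → ℂ) (f : ℍ → ℂ) : Prop
    extends IsModularForm Γ r mu f where
  cuspidal : ∀ (𝔞 : OnePoint ℚ) (σ : SL(2, ℝ)), IsScalingMatrix Γ 𝔞 σ →
    0 < cuspParam (slash r σ f) ∨ fourierCoef (slash r σ f) 0 = 0

/-- The function `z ↦ g (m z)`. -/
def dilate (m : ℕ) (g : ℍ → ℂ) (z : ℍ) : ℂ := g (ofComplex ((m : ℂ) * z))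

/-- The partial sum over `0 ≤ n < N`, `n + κ > 0`, of the series
`∑ a_n / (n + κ) ^ α * exp (2 π i (n + κ) x / m)`, where
`g (m z) = ∑ a_n exp (2 π i (n + κ) z)`. -/
def fracPartialSum (m : ℕ) (g : ℍ → ℂ) (α : ℝ) (N : ℕ) (x : ℝ) : ℂ :=
  ∑ n ∈ Finset.range N,
    if 0 < (n : ℝ) + cuspParam (dilate m g) then
      fourierCoef (dilate m g) n / (((n + cuspParam (dilate m g)) ^ α : ℝ) : ℂ) *
        Complex.exp (2 * Real.pi * Complex.I * (n + cuspParam (dilate m g) : ℝ) * (x / m))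
    else 0

/-- The `α`-fractional integral `g_α` of a function whose cusp `∞` has width `m`: the sum of the
(possibly only conditionally convergent) series whose partial sums are `fracPartialSum`. -/
def fracIntegral (m : ℕ) (g : ℍ → ℂ) (α : ℝ) (x : ℝ) : ℂ :=
  Filter.limUnder Filter.atTop fun N : ℕ => fracPartialSum m g α N x

/-- The Möbius action of a real matrix on a real number that is not its pole. -/
def moebius (g : SL(2, ℝ)) (x : ℝ) : ℝ := (g 0 0 * x + g 0 1) / (g 1 0 * x + g 1 1)

/-- `ψ(x) = x ^ (α - r)` if `α - r` is not an integer, and `x ^ (α - r) * log x` if it is. -/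
def psi (α r : ℝ) (x : ℝ) : ℂ :=
  open Classical in
  if ∃ k : ℤ, α - r = k then (x : ℂ) ^ ((α - r : ℝ) : ℂ) * Complex.log x
  else (x : ℂ) ^ ((α - r : ℝ) : ℂ)

/-- The error term `E(x)` in the approximate functional equation
`f_α(x) = A i^(-α) f(x₀) ψ(x - x₀) + B |x - x₀|^(2α) (x - x₀)^(-r) f_α^σ(σ⁻¹ x) + E(x)`.
For `α > 0` the second summand is `0` at `x = x₀`, where `σ⁻¹` has its pole. -/
def approxError (Γ : Subgroup SL(2, ℤ)) (r α : ℝ) (f : ℍ → ℂ) (x₀ : ℚ) (σ : SL(2, ℝ))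
    (A B : ℝ) (x : ℝ) : ℂ :=
  fracIntegral (cuspWidth Γ OnePoint.infty) f α x
    - (A * Complex.I ^ (-α : ℂ) * valueAtInfty (slash r σ f) * psi α r (x - x₀)
      + B * ((|x - x₀| ^ (2 * α) : ℝ) : ℂ) * ((x - x₀ : ℝ) : ℂ) ^ (-r : ℂ)
        * fracIntegral 1 (slash r σ f) α (moebius σ⁻¹ x))

/-- The integrand `(z - x) ^ (r - 2) f z dz` on the vertical ray `z = x₀ + i t`, `t > 0`. -/
def eichlerIntegrand (r : ℝ) (f : ℍ → ℂ) (x₀ x t : ℝ) : ℂ :=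
  ((x₀ + t * Complex.I) - x : ℂ) ^ ((r - 2 : ℝ) : ℂ) * f (ofComplex (x₀ + t * Complex.I))
    * Complex.I

/-- The Eichler integral `(2π)^(r-1) / ((i m)^(r-1) Γ(r-1)) ∫_(x₀) (z - x)^(r-2) f z dz` along the
vertical ray from `x₀` to `i∞`. -/
def periodIntegral (m : ℕ) (r : ℝ) (f : ℍ → ℂ) (x₀ x : ℝ) : ℂ :=
  (((2 * Real.pi) ^ (r - 1) : ℝ) : ℂ)
    / ((Complex.I * m) ^ ((r - 1 : ℝ) : ℂ) * ((Real.Gamma (r - 1) : ℝ) : ℂ))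
    * ∫ t in Set.Ioi (0 : ℝ), eichlerIntegrand r f x₀ x t

end FracModular

end

open scoped MatrixGroups
open scoped Manifold

noncomputable section

namespace FracModular

open UpperHalfPlane Matrix MeasureTheory Filter Topology Asymptotics

/-! Put α = r - 1. Euler's integral for Γ(α) writes each term of f_α(x) as a Mellin transform of the
corresponding Fourier term of f on the vertical ray above x. Hence f_α(x) is a constant times the
integral of (z - x)^(r-2) f(z) dz from x to i∞, and likewise for f^σ_α at y = σ⁻¹x. For x ≠ x₀ the
substitution z = σw carries the ray from y to i∞ to a path from x to x₀ = σ(∞), and carries the form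
(z - x)^(r-2) f(z) dz to (w - y)^(r-2) f^σ(w) dw times a factor proportional to |x - x₀|^(2α) (x -
x₀)^(-r) (`kernel_transform`, `hasDerivAt_comp_smul`). The integrand is holomorphic, so the integral
from x to i∞ minus the one from x to x₀ equals the integral from x₀ to i∞ (`integral_eichler_eq`).
This is the functional equation, with E the Eichler integral.

Two analytic facts make this rigorous. The first is Hecke's bound: |f| (Im z)^(r/2) is bounded on
the upper half-plane (`IsCuspForm.exists_bound`), so both f and f^σ are O((Im z)^(-r/2)). With
exponential decay at i∞, the integrals starting at a real point converge as soon as r/2 < r - 1,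
which is r > 2.

The second is convergence of the series in the sense of partial sums
(`IsTwistedForm.tendsto_fracSum`). A partial sum at height t is a convolution of the function at
height t/2 with a geometric kernel, hence O(t^(-r/2-ε)) uniformly in its length; dominated
convergence then passes to the limit under the Mellin integral.

The powers cause no trouble because the normalization c < 0 puts j_σ in the lower half-plane, so its
argument and that of a point of the upper half-plane add up without leaving (-π, π]. For integral r
the kernel is a polynomial in x by the binomial theorem, and so is E. -/

/-- The function `z ↦ exp (-2 π i κ z) g z`. -/
def untwist (κ : ℝ) (g : ℍ → ℂ) (z : ℍ) : ℂ :=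
  Complex.exp (-(2 * Real.pi * Complex.I * κ * z)) * g z

/-- `g (z + 1) = exp (2 π i κ) g z`. -/
def IsTwisted (κ : ℝ) (g : ℍ → ℂ) : Prop :=
  ∀ z : ℍ, g ((1 : ℝ) +ᵥ z) = Complex.exp (2 * Real.pi * Complex.I * κ) * g z

/-! ### Twisted periodic functions and their Fourier expansions -/

theorem norm_exp_mul_coe (a : ℝ) (z : ℂ) :
    ‖Complex.exp (2 * Real.pi * Complex.I * a * z)‖ = Real.exp (-(2 * Real.pi * a * z.im)) := by
  rw [Complex.norm_exp]
  congr 1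
  simp [Complex.mul_re, Complex.mul_im]

theorem norm_untwist (κ : ℝ) (g : ℍ → ℂ) (z : ℍ) :
    ‖untwist κ g z‖ = Real.exp (2 * Real.pi * κ * z.im) * ‖g z‖ := by
  have h := norm_exp_mul_coe (-κ) (z : ℂ)
  rw [untwist, norm_mul]
  congr 1
  convert h using 2 <;> push_cast <;> simp

theorem ofComplex_add_one {w : ℂ} (hw : 0 < w.im) :
    ofComplex (w + 1) = (1 : ℝ) +ᵥ ofComplex w := by
  apply UpperHalfPlane.ext
  have h1 : 0 < (w + 1).im := by simpa using hw
  rw [ofComplex_apply_of_im_pos h1, coe_vadd, ofComplex_apply_of_im_pos hw]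
  simp [add_comm]

theorem periodic_comp_ofComplex_of_vadd {u : ℍ → ℂ} (h : ∀ z : ℍ, u ((1 : ℝ) +ᵥ z) = u z) :
    Function.Periodic (u ∘ ofComplex) ((1 : ℝ) : ℂ) := by
  intro w
  by_cases hw : 0 < w.im
  · simp only [Function.comp_apply, Complex.ofReal_one]
    rw [ofComplex_add_one hw, h]
  · simp only [Function.comp_apply]
    rw [ofComplex_apply_eq_of_im_nonpos (w := w + (1 : ℝ)) (w' := w)] <;> simpa using hw

theorem untwist_vadd {κ : ℝ} {g : ℍ → ℂ} (hg : IsTwisted κ g) (z : ℍ) :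
    untwist κ g ((1 : ℝ) +ᵥ z) = untwist κ g z := by
  rw [untwist, untwist, hg z, ← mul_assoc, ← Complex.exp_add, coe_vadd]
  congr 2
  push_cast
  ring

theorem periodic_untwist {κ : ℝ} {g : ℍ → ℂ} (hg : IsTwisted κ g) :
    Function.Periodic (untwist κ g ∘ ofComplex) ((1 : ℝ) : ℂ) :=
  periodic_comp_ofComplex_of_vadd (untwist_vadd hg)

theorem differentiableOn_untwist {κ : ℝ} {g : ℍ → ℂ}
    (hg : DifferentiableOn ℂ (g ∘ ofComplex) {z : ℂ | 0 < z.im}) :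
    DifferentiableOn ℂ (untwist κ g ∘ ofComplex) {z : ℂ | 0 < z.im} := by
  have h : DifferentiableOn ℂ
      (fun z : ℂ => Complex.exp (-(2 * Real.pi * Complex.I * κ * z)) * (g ∘ ofComplex) z)
      {z : ℂ | 0 < z.im} :=
    DifferentiableOn.mul (Differentiable.differentiableOn (by fun_prop)) hg
  refine h.congr fun z hz => ?_
  simp only [Function.comp_apply, untwist]
  rw [ofComplex_apply_of_im_pos hz]

theorem mdifferentiable_untwist {κ : ℝ} {g : ℍ → ℂ}
    (hg : DifferentiableOn ℂ (g ∘ ofComplex) {z : ℂ | 0 < z.im}) : MDiff (untwist κ g) :=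
  mdifferentiable_iff.2 (differentiableOn_untwist hg)

/-- A twisted periodic holomorphic function of polynomial growth has no negative frequencies. -/
theorem isBoundedAtImInfty_untwist {κ : ℝ} {g : ℍ → ℂ} (hκ : κ < 1) (hg : IsTwisted κ g)
    (hol : DifferentiableOn ℂ (g ∘ ofComplex) {z : ℂ | 0 < z.im}) {K : ℝ}
    (hb : g =O[atImInfty] fun z => z.im ^ K) : IsBoundedAtImInfty (untwist κ g) := by
  -- The multiplier determines κ only modulo 1. Untwisting with κ - 1 < 0 yields a periodic function
  -- that tends to 0, because the exponential beats the polynomial growth. Its q-expansion then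
  -- starts at q, and the decay exp(-2πy) so gained is what boundedness with κ itself requires.
  have hg1 : IsTwisted (κ - 1) g := fun z => by
    rw [hg z]
    congr 1
    rw [Complex.exp_eq_exp_iff_exists_int]
    exact ⟨1, by push_cast; ring⟩
  have hlim : Tendsto (fun z : ℍ => Real.exp (-(2 * Real.pi * (1 - κ)) * z.im) * z.im ^ K)
      atImInfty (𝓝 0) := by
    have h1 := tendsto_rpow_mul_exp_neg_mul_atTop_nhds_zero K (2 * Real.pi * (1 - κ))
      (by have := Real.pi_pos; have : 0 < 1 - κ := by linarith
          positivity)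
    have h2 : Tendsto UpperHalfPlane.im atImInfty atTop := tendsto_comap
    refine (h1.comp h2).congr fun z => ?_
    simp [mul_comm]
  have hzero : IsZeroAtImInfty (untwist (κ - 1) g) := by
    have hO : untwist (κ - 1) g =O[atImInfty]
        fun z => Real.exp (-(2 * Real.pi * (1 - κ)) * z.im) * z.im ^ K := by
      have : untwist (κ - 1) g = fun z : ℍ => Complex.exp (-(2 * Real.pi * Complex.I * (κ - 1 : ℝ) * (z : ℂ)))
        * g z := by ext z; simp [untwist]
      rw [this]
      refine IsBigO.mul (IsBigO.of_bound 1 (Eventually.of_forall fun z => ?_)) hb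
      rw [one_mul, Real.norm_of_nonneg (Real.exp_pos _).le,
        show -(2 * Real.pi * Complex.I * ((κ - 1 : ℝ) : ℂ) * (z : ℂ))
          = 2 * Real.pi * Complex.I * ((-(κ - 1) : ℝ) : ℂ) * (z : ℂ) by push_cast; ring,
        norm_exp_mul_coe, coe_im]
      refine le_of_eq ?_
      congr 1
      ring
    exact hO.trans_tendsto hlim
  have hexp := hzero.exp_decay_atImInfty one_pos (periodic_untwist hg1)
    (mdifferentiable_untwist hol) hzero.isBoundedAtImInfty
  rw [isBigO_iff] at hexp
  obtain ⟨C, hC⟩ := hexp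
  refine IsBigO.of_bound C ?_
  filter_upwards [hC] with z hz
  rw [norm_untwist, Real.norm_of_nonneg (Real.exp_pos _).le] at hz
  rw [norm_untwist]
  have e1 : Real.exp (2 * Real.pi * κ * z.im)
    = Real.exp (2 * Real.pi * z.im) * Real.exp (2 * Real.pi * (κ - 1) * z.im) := by
    rw [← Real.exp_add]; ring_nf
  rw [e1, mul_assoc]
  calc _ ≤ Real.exp (2 * Real.pi * z.im) * (C * Real.exp (-2 * Real.pi * z.im / 1)) := by gcongr
    _ = C * (Real.exp (2 * Real.pi * z.im) * Real.exp (-2 * Real.pi * z.im / 1)) := by ring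
    _ = C * ‖(1 : ℍ → ℝ) z‖ := by rw [← Real.exp_add]; simp

/-- The frequency-`n + κ` coefficient, computed at any height. -/
def twistedCoef (κ : ℝ) (g : ℍ → ℂ) (n : ℕ) : ℂ := (qExpansion 1 (untwist κ g)).coeff n

theorem twistedCoef_eq_integral {κ : ℝ} {g : ℍ → ℂ} (hg : IsTwisted κ g)
    (hol : DifferentiableOn ℂ (g ∘ ofComplex) {z : ℂ | 0 < z.im})
    (hb : IsBoundedAtImInfty (untwist κ g)) (n : ℕ) {t : ℝ} (ht : 0 < t) :
    twistedCoef κ g n = ∫ u in (0 : ℝ)..1, g (ofComplex (u + t * Complex.I)) *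
      Complex.exp (-(2 * Real.pi * Complex.I * (n + κ : ℝ) * (u + t * Complex.I))) := by
  rw [twistedCoef, qExpansion_coeff_eq_intervalIntegral one_pos (periodic_untwist hg)
    (mdifferentiable_untwist hol) hb n ht]
  simp only [Complex.ofReal_one, div_one, one_mul]
  refine intervalIntegral.integral_congr fun u _ => ?_
  have him : 0 < ((u : ℂ) + t * Complex.I).im := by simpa using ht
  simp only [ofComplex_apply_of_im_pos him, untwist, Function.Periodic.qParam]
  rw [← mul_assoc, mul_comm (g _)]
  congr 1
  rw [one_div, ← Complex.exp_nat_mul, ← Complex.exp_neg, ← Complex.exp_add]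
  congr 1
  push_cast
  ring

theorem hasSum_twistedCoef {κ : ℝ} {g : ℍ → ℂ} (hg : IsTwisted κ g)
    (hol : DifferentiableOn ℂ (g ∘ ofComplex) {z : ℂ | 0 < z.im})
    (hb : IsBoundedAtImInfty (untwist κ g)) (z : ℍ) :
    HasSum (fun n : ℕ => twistedCoef κ g n *
      Complex.exp (2 * Real.pi * Complex.I * (n + κ : ℝ) * z)) (g z) := by
  have h := (hasSum_qExpansion one_pos (periodic_untwist hg)
    (mdifferentiable_untwist hol) hb z).mul_left (Complex.exp (2 * Real.pi * Complex.I * κ * z))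
  have e : Complex.exp (2 * Real.pi * Complex.I * κ * z) * untwist κ g z = g z := by
    rw [untwist, ← mul_assoc, ← Complex.exp_add]
    simp
  rw [e] at h
  have e2 : (fun n : ℕ => twistedCoef κ g n *
      Complex.exp (2 * Real.pi * Complex.I * (n + κ : ℝ) * z)) = fun n : ℕ =>
      Complex.exp (2 * Real.pi * Complex.I * κ * z) *
        ((qExpansion 1 (untwist κ g)).coeff n • Function.Periodic.qParam 1 z ^ n) := by
    ext n
    simp only [twistedCoef, smul_eq_mul, Function.Periodic.qParam, ← Complex.exp_nat_mul]
    rw [mul_left_comm, ← Complex.exp_add]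
    congr 2
    push_cast
    ring
  rw [e2]
  exact h

theorem isZeroAtImInfty_untwist_sub {κ : ℝ} {g : ℍ → ℂ} (hg : IsTwisted κ g)
    (hol : DifferentiableOn ℂ (g ∘ ofComplex) {z : ℂ | 0 < z.im})
    (hb : IsBoundedAtImInfty (untwist κ g)) (h0 : twistedCoef κ g 0 = 0) :
    IsZeroAtImInfty (untwist κ g) := by
  have hper := periodic_untwist hg
  have hmd := mdifferentiable_untwist (κ := κ) hol
  have hv : UpperHalfPlane.valueAtInfty (untwist κ g) = 0 := by
    rw [← h0, twistedCoef, qExpansion_coeff_zero one_pos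
      (analyticAt_cuspFunction_zero one_pos hper hmd hb) hper]
  have h := exp_decay_sub_atImInfty one_pos hper hmd hb
  simp only [hv, sub_zero] at h
  refine h.trans_tendsto ?_
  have h2 : Tendsto UpperHalfPlane.im atImInfty atTop := tendsto_comap
  refine (Real.tendsto_exp_atBot.comp ?_)
  simp only [div_one]
  exact h2.const_mul_atTop_of_neg (by have := Real.pi_pos; linarith)

/-- A twisted periodic function that is cuspidal at infinity decays exponentially. -/
theorem exists_isBigO_exp {κ : ℝ} {g : ℍ → ℂ} (hg : IsTwisted κ g)
    (hol : DifferentiableOn ℂ (g ∘ ofComplex) {z : ℂ | 0 < z.im})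
    (hb : IsBoundedAtImInfty (untwist κ g)) (hκ : 0 ≤ κ) (hc : 0 < κ ∨ twistedCoef κ g 0 = 0) :
    ∃ δ > 0, g =O[atImInfty] fun z => Real.exp (-δ * z.im) := by
  have key : ∀ z, ‖g z‖ = Real.exp (-(2 * Real.pi * κ * z.im)) * ‖untwist κ g z‖ := fun z => by
    rw [norm_untwist, ← mul_assoc, ← Real.exp_add]; simp
  rcases hc with h | h
  · refine ⟨2 * Real.pi * κ, by positivity, ?_⟩
    obtain ⟨C, hC⟩ := isBigO_iff.1 hb
    refine IsBigO.of_bound C ?_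
    filter_upwards [hC] with z hz
    rw [key, Real.norm_of_nonneg (Real.exp_pos _).le, mul_comm]
    simp only [Pi.one_apply, norm_one, mul_one] at hz
    rw [neg_mul]
    gcongr
  · refine ⟨2 * Real.pi, by positivity, ?_⟩
    have hz := isZeroAtImInfty_untwist_sub hg hol hb h
    have := hz.exp_decay_atImInfty one_pos (periodic_untwist hg) (mdifferentiable_untwist hol) hb
    obtain ⟨C, hC⟩ := isBigO_iff.1 this
    refine IsBigO.of_bound C ?_
    filter_upwards [hC] with z hz
    rw [key]
    have h1 : Real.exp (-(2 * Real.pi * κ * z.im)) ≤ 1 := by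
      rw [Real.exp_le_one_iff]
      have := z.im_pos
      simp only [Left.neg_nonpos_iff]
      positivity
    calc _ ≤ 1 * ‖untwist κ g z‖ := by gcongr
      _ ≤ _ := by rw [one_mul]; convert hz using 4; ring

/-! ### Twisted forms with a power bound near the real axis -/

/-- A holomorphic function on the upper half-plane with `g (z + 1) = exp (2 π i κ) g z` and
`‖g z‖ ≤ C (im z) ^ (-β)`. -/
structure IsTwistedForm (κ β C : ℝ) (g : ℍ → ℂ) : Prop where
  twist : IsTwisted κ g
  holo : DifferentiableOn ℂ (g ∘ ofComplex) {z : ℂ | 0 < z.im}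
  nonneg : 0 ≤ κ
  lt_one : κ < 1
  pos : 0 < β
  bound : ∀ z : ℍ, ‖g z‖ ≤ C * z.im ^ (-β)

theorem continuousOn_vertical {g : ℍ → ℂ}
    (hol : DifferentiableOn ℂ (g ∘ ofComplex) {z : ℂ | 0 < z.im}) (x : ℝ) :
    ContinuousOn (fun t : ℝ => g (ofComplex (x + t * Complex.I))) (Set.Ioi 0) := by
  refine hol.continuousOn.comp (f := fun t : ℝ => (x : ℂ) + t * Complex.I)
    (Continuous.continuousOn (by fun_prop)) fun t ht => ?_
  simpa using ht

theorem continuous_horizontal {g : ℍ → ℂ}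
    (hol : DifferentiableOn ℂ (g ∘ ofComplex) {z : ℂ | 0 < z.im}) {t : ℝ} (ht : 0 < t) :
    Continuous fun u : ℝ => g (ofComplex (u + t * Complex.I)) := by
  rw [← continuousOn_univ]
  refine hol.continuousOn.comp (f := fun u : ℝ => (u : ℂ) + t * Complex.I)
    (Continuous.continuousOn (by fun_prop)) fun t _ => ?_
  simpa using ht

theorem im_ofComplex_add {x t : ℝ} (ht : 0 < t) : (ofComplex (x + t * Complex.I)).im = t := by
  have h : 0 < ((x : ℂ) + t * Complex.I).im := by simpa using ht
  rw [ofComplex_apply_of_im_pos h, ← coe_im]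
  simp

theorem coe_ofComplex_add {x t : ℝ} (ht : 0 < t) :
    ((ofComplex (x + t * Complex.I) : ℍ) : ℂ) = x + t * Complex.I := by
  have h : 0 < ((x : ℂ) + t * Complex.I).im := by simpa using ht
  rw [ofComplex_apply_of_im_pos h]

namespace IsTwistedForm

variable {κ β C : ℝ} {g : ℍ → ℂ}

theorem const_nonneg (h : IsTwistedForm κ β C g) : 0 ≤ C := by
  have := h.bound UpperHalfPlane.I
  simp only [I_im, Real.one_rpow, mul_one] at this
  exact (norm_nonneg _).trans this

theorem bounded (h : IsTwistedForm κ β C g) : IsBoundedAtImInfty (untwist κ g) := by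
  refine isBoundedAtImInfty_untwist h.lt_one h.twist h.holo (K := -β)
    (IsBigO.of_bound C (Eventually.of_forall fun z => ?_))
  rw [Real.norm_of_nonneg (Real.rpow_nonneg z.im_pos.le _)]
  exact h.bound z

theorem coef_eq_integral (h : IsTwistedForm κ β C g) (n : ℕ) {t : ℝ} (ht : 0 < t) :
    twistedCoef κ g n = ∫ u in (0 : ℝ)..1, g (ofComplex (u + t * Complex.I)) *
      Complex.exp (-(2 * Real.pi * Complex.I * (n + κ : ℝ) * (u + t * Complex.I))) :=
  twistedCoef_eq_integral h.twist h.holo h.bounded n ht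

theorem hasSum (h : IsTwistedForm κ β C g) (z : ℍ) :
    HasSum (fun n : ℕ => twistedCoef κ g n *
      Complex.exp (2 * Real.pi * Complex.I * (n + κ : ℝ) * z)) (g z) :=
  hasSum_twistedCoef h.twist h.holo h.bounded z

/-- Since β > 0, the bound C y^(-β) tends to 0 as y → ∞, so the constant term vanishes: the power
bound alone already encodes cuspidality at infinity. -/
theorem coef_zero (h : IsTwistedForm κ β C g) (hκ : κ = 0) : twistedCoef κ g 0 = 0 := by
  subst hκ
  have hmd := mdifferentiable_untwist (κ := 0) h.holo
  have hper := periodic_untwist h.twist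
  rw [twistedCoef, qExpansion_coeff_zero one_pos
    (analyticAt_cuspFunction_zero one_pos hper hmd h.bounded) hper]
  apply IsZeroAtImInfty.valueAtInfty_eq_zero
  have h2 : Tendsto UpperHalfPlane.im atImInfty atTop := tendsto_comap
  have h3 : Tendsto (fun z : ℍ => C * z.im ^ (-β)) atImInfty (𝓝 0) := by
    simpa using ((tendsto_rpow_neg_atTop h.pos).comp h2).const_mul C
  refine squeeze_zero_norm (fun z => ?_) h3
  rw [norm_untwist]
  simpa using h.bound z

/-- The least frequency occurring in the expansion is positive. -/
theorem exists_freq_bound (h : IsTwistedForm κ β C g) :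
    ∃ δ > 0, ∀ n : ℕ, twistedCoef κ g n = 0 ∨ δ ≤ n + κ := by
  rcases h.nonneg.lt_or_eq with hκ | hκ
  · exact ⟨κ, hκ, fun n => Or.inr (by simp)⟩
  · refine ⟨1, one_pos, fun n => ?_⟩
    rcases Nat.eq_zero_or_pos n with rfl | hn
    · exact Or.inl (h.coef_zero hκ.symm)
    · right
      have : (1 : ℝ) ≤ n := by exact_mod_cast hn
      linarith

end IsTwistedForm

/-! ### Uniform bounds for partial sums -/

/-- The distance from q to 1 is at least a constant times t (radially) and at least a constant times
|v| (angularly); a weighted geometric mean interpolates. The mean is chosen so that its inverse, as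
a function of v, has the integrable singularity |v|^(ε-1), at the price of only t^(-ε). -/
theorem le_norm_one_sub_exp {t v : ℝ} (ht : 0 < t) (ht1 : t ≤ 1) (hv : |v| ≤ 1 / 2) {ε : ℝ}
    (hε : 0 < ε) (hε1 : ε < 1) :
    Real.exp (-Real.pi) * (t ^ ε * |v| ^ (1 - ε)) ≤
      ‖1 - Complex.exp (2 * Real.pi * Complex.I * (-v + (t / 2 : ℝ) * Complex.I))‖ := by
  set q := Complex.exp (2 * Real.pi * Complex.I * (-v + (t / 2 : ℝ) * Complex.I)) with hq
  have hpi := Real.pi_gt_three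
  set ρ := Real.exp (-(Real.pi * t)) with hρ
  have hqe : q = ρ * (Real.cos (2 * Real.pi * v) - Real.sin (2 * Real.pi * v) * Complex.I) := by
    rw [hq, show 2 * Real.pi * Complex.I * (-v + (t / 2 : ℝ) * Complex.I)
      = ((-(Real.pi * t) : ℝ) : ℂ) + ((-(2 * Real.pi * v) : ℝ) : ℂ) * Complex.I by
        push_cast; ring_nf; simp [Complex.I_sq]; ring, Complex.exp_add, Complex.exp_mul_I,
      ← Complex.ofReal_exp, ← Complex.ofReal_cos, ← Complex.ofReal_sin]
    simp [hρ, Real.cos_neg, Real.sin_neg, sub_eq_add_neg]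
  have hρ0 : 0 < ρ := Real.exp_pos _
  have hρ1 : ρ ≤ 1 := by
    rw [hρ, Real.exp_le_one_iff]
    have : 0 < Real.pi * t := by positivity
    linarith
  have hρ2 : Real.exp (-Real.pi) ≤ ρ := by
    rw [hρ, Real.exp_le_exp]
    nlinarith
  have hnq : ‖q‖ = ρ := by
    rw [hq, Complex.norm_exp, hρ]
    congr 1
    simp [Complex.mul_re, Complex.mul_im]
    ring
  have h1 : Real.exp (-Real.pi) * t ≤ ‖1 - q‖ := by
    have h2 : 1 - ρ ≤ ‖1 - q‖ := by
      have := norm_sub_norm_le (1 : ℂ) q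
      rwa [hnq, norm_one] at this
    refine le_trans ?_ h2
    have h3 : Real.pi * t + 1 ≤ Real.exp (Real.pi * t) := Real.add_one_le_exp _
    have h4 : ρ * Real.exp (Real.pi * t) = 1 := by rw [hρ, ← Real.exp_add]; simp
    have h5 : ρ * (Real.pi * t) ≤ 1 - ρ := by nlinarith
    refine le_trans ?_ h5
    have : t ≤ Real.pi * t := by nlinarith
    gcongr
  have h2 : Real.exp (-Real.pi) * |v| ≤ ‖1 - q‖ := by
    refine le_trans (mul_le_mul_of_nonneg_right hρ2 (abs_nonneg v)) ?_
    refine abs_le_of_sq_le_sq' ?_ (norm_nonneg _) |>.2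
    -- Jordan's inequality, available because |πv| ≤ π/2.
    have hs : 2 * |v| ≤ |Real.sin (Real.pi * v)| := by
      have := Real.mul_abs_le_abs_sin (x := Real.pi * v) (by
        rw [abs_mul, abs_of_pos Real.pi_pos]; nlinarith)
      rw [abs_mul, abs_of_pos Real.pi_pos] at this
      convert this using 1
      field_simp
    have hs2 : 4 * v ^ 2 ≤ Real.sin (Real.pi * v) ^ 2 := by
      rw [← sq_abs v, ← sq_abs (Real.sin _)]
      nlinarith [abs_nonneg v]
    have hc : Real.cos (2 * Real.pi * v) = 1 - 2 * Real.sin (Real.pi * v) ^ 2 := by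
      rw [show 2 * Real.pi * v = 2 * (Real.pi * v) by ring, Real.cos_two_mul, Real.cos_sq']
      ring
    have hsc := Real.sin_sq_add_cos_sq (2 * Real.pi * v)
    have hn : ‖1 - q‖ ^ 2 = (1 - ρ) ^ 2 + 4 * ρ * Real.sin (Real.pi * v) ^ 2 := by
      rw [← Complex.normSq_eq_norm_sq, Complex.normSq_apply, hqe]
      simp only [Complex.sub_re, Complex.one_re, Complex.mul_re, Complex.ofReal_re,
        Complex.ofReal_im, Complex.I_re, Complex.I_im, Complex.sub_im, Complex.one_im,
        Complex.mul_im]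
      linear_combination ρ ^ 2 * hsc - 2 * ρ * hc
    rw [hn, mul_pow, sq_abs]
    nlinarith [sq_nonneg (1 - ρ), sq_nonneg v, mul_nonneg hρ0.le (sq_nonneg v),
      mul_le_mul_of_nonneg_left hs2 hρ0.le,
      mul_nonneg (mul_nonneg hρ0.le (sub_nonneg.2 hρ1)) (sq_nonneg v)]
  have h3 := Real.geom_mean_le_arith_mean2_weighted hε.le (sub_nonneg.2 hε1.le) ht.le
    (abs_nonneg v) (by ring)
  calc _ ≤ Real.exp (-Real.pi) * (ε * t + (1 - ε) * |v|) := by gcongr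
    _ = ε * (Real.exp (-Real.pi) * t) + (1 - ε) * (Real.exp (-Real.pi) * |v|) := by ring
    _ ≤ ε * ‖1 - q‖ + (1 - ε) * ‖1 - q‖ := by
      have : 0 ≤ 1 - ε := by linarith
      gcongr
    _ = ‖1 - q‖ := by ring

theorem norm_geom_sum_le {q : ℂ} (hq : ‖q‖ ≤ 1) (hq1 : q ≠ 1) (N : ℕ) :
    ‖∑ n ∈ Finset.range N, q ^ n‖ ≤ 2 / ‖1 - q‖ := by
  rw [geom_sum_eq hq1, norm_div, norm_sub_rev q 1]
  gcongr
  calc ‖q ^ N - 1‖ ≤ ‖q ^ N‖ + ‖(1 : ℂ)‖ := norm_sub_le _ _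
    _ ≤ 1 + 1 := by rw [norm_pow, norm_one]; gcongr; exact pow_le_one₀ (norm_nonneg _) hq
    _ = 2 := by norm_num

/-- The kernel of the partial sum operator on a horizontal line. -/
theorem norm_sum_exp_le {κ t v : ℝ} (hκ : 0 ≤ κ) (ht : 0 < t) (ht1 : t ≤ 1) (hv : |v| ≤ 1 / 2)
    (hv0 : v ≠ 0) {ε : ℝ} (hε : 0 < ε) (hε1 : ε < 1) (N : ℕ) :
    ‖∑ n ∈ Finset.range N,
      Complex.exp (2 * Real.pi * Complex.I * (n + κ : ℝ) * (-v + (t / 2 : ℝ) * Complex.I))‖ ≤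
      2 * Real.exp Real.pi * t ^ (-ε) * |v| ^ (ε - 1) := by
  set w : ℂ := -v + (t / 2 : ℝ) * Complex.I with hw
  set q := Complex.exp (2 * Real.pi * Complex.I * w) with hq
  have hwim : w.im = t / 2 := by simp [hw]
  have hv' : 0 < |v| := abs_pos.2 hv0
  have hlow := le_norm_one_sub_exp ht ht1 hv hε hε1
  rw [← hw, ← hq] at hlow
  have hpos : 0 < Real.exp (-Real.pi) * (t ^ ε * |v| ^ (1 - ε)) := by positivity
  have hq1 : q ≠ 1 := by
    rintro h
    rw [h, sub_self, norm_zero] at hlow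
    linarith
  have hqn : ‖q‖ ≤ 1 := by
    have := norm_exp_mul_coe 1 w
    rw [Complex.ofReal_one, mul_one] at this
    rw [hq, this, Real.exp_le_one_iff, hwim]
    have := Real.pi_pos
    simp only [Left.neg_nonpos_iff]
    positivity
  have hsum : ∑ n ∈ Finset.range N, Complex.exp (2 * Real.pi * Complex.I * (n + κ : ℝ) * w)
      = Complex.exp (2 * Real.pi * Complex.I * κ * w) * ∑ n ∈ Finset.range N, q ^ n := by
    rw [Finset.mul_sum]
    refine Finset.sum_congr rfl fun n _ => ?_
    rw [hq, ← Complex.exp_nat_mul, ← Complex.exp_add]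
    congr 1
    push_cast
    ring
  rw [hsum, norm_mul, norm_exp_mul_coe]
  have he : Real.exp (-(2 * Real.pi * κ * w.im)) ≤ 1 := by
    rw [Real.exp_le_one_iff, hwim]
    have := Real.pi_pos
    simp only [Left.neg_nonpos_iff]
    positivity
  calc _ ≤ 1 * (2 / ‖1 - q‖) := by gcongr; exact norm_geom_sum_le hqn hq1 N
    _ ≤ 2 / (Real.exp (-Real.pi) * (t ^ ε * |v| ^ (1 - ε))) := by rw [one_mul]; gcongr
    _ = _ := by
      rw [Real.rpow_neg ht.le, show ε - 1 = -(1 - ε) by ring, Real.rpow_neg hv'.le,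
        Real.exp_neg]
      field_simp

theorem intervalIntegrable_abs_rpow {s : ℝ} (hs : -1 < s) (a b : ℝ) :
    IntervalIntegrable (fun v : ℝ => |v| ^ s) volume a b := by
  have h := (intervalIntegral.intervalIntegrable_cpow' (a := a) (b := b) (r := (s : ℂ))
    (by simpa using hs)).norm
  refine h.congr_ae ?_
  have h0 : ∀ᵐ v : ℝ, v ≠ 0 := by simp [ae_iff, measure_singleton]
  refine ae_restrict_of_ae ?_
  filter_upwards [h0] with v hv
  rw [Complex.norm_cpow_of_ne_zero (by exact_mod_cast hv)]
  simp

namespace IsTwistedForm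

variable {κ β C : ℝ} {g : ℍ → ℂ}

/-- The coefficient is computed at height t/2 while the exponential sits at height t, so half of the
decay remains in the integral kernel. Summed over n, the kernel is geometric and g factors out.
Periodicity of the whole integrand recentres the interval at x. -/
theorem coef_mul_exp_eq (h : IsTwistedForm κ β C g) (n : ℕ) (x : ℝ) {t : ℝ} (ht : 0 < t) :
    twistedCoef κ g n *
        Complex.exp (2 * Real.pi * Complex.I * (n + κ : ℝ) * (x + t * Complex.I)) =
      ∫ v in (-(1 / 2) : ℝ)..(1 / 2), g (ofComplex ((x + v : ℝ) + (t / 2 : ℝ) * Complex.I)) *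
        Complex.exp (2 * Real.pi * Complex.I * (n + κ : ℝ) * (-v + (t / 2 : ℝ) * Complex.I)) := by
  set P : ℝ → ℂ := fun u => g (ofComplex (u + (t / 2 : ℝ) * Complex.I)) *
    Complex.exp (2 * Real.pi * Complex.I * (n + κ : ℝ) * (x - u + (t / 2 : ℝ) * Complex.I))
    with hP
  have ht2 : 0 < t / 2 := by positivity
  have hper : Function.Periodic P 1 := by
    intro u
    simp only [hP]
    have him : 0 < ((u : ℂ) + (t / 2 : ℝ) * Complex.I).im := by simpa using ht
    rw [show (((u + 1 : ℝ) : ℂ) + (t / 2 : ℝ) * Complex.I) = (u + (t / 2 : ℝ) * Complex.I) + 1 by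
      push_cast; ring, ofComplex_add_one him, h.twist, mul_right_comm, mul_comm,
      mul_comm (Complex.exp _) (Complex.exp _), ← Complex.exp_add]
    congr 1
    rw [Complex.exp_eq_exp_iff_exists_int]
    exact ⟨-n, by push_cast; ring⟩
  have h1 : twistedCoef κ g n *
      Complex.exp (2 * Real.pi * Complex.I * (n + κ : ℝ) * (x + t * Complex.I))
      = ∫ u in (0 : ℝ)..(0 + 1), P u := by
    rw [h.coef_eq_integral n ht2, ← intervalIntegral.integral_mul_const, zero_add]
    refine intervalIntegral.integral_congr fun u _ => ?_
    simp only [hP]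
    rw [mul_assoc, ← Complex.exp_add]
    congr 2
    push_cast
    ring
  rw [h1, hper.intervalIntegral_add_eq 0 (x + -(1 / 2)), show x + -(1 / 2) + 1 = x + 1 / 2 by ring,
    ← intervalIntegral.integral_comp_add_left]
  refine intervalIntegral.integral_congr fun v _ => ?_
  simp only [hP]
  congr 3
  push_cast
  ring

/-- Uniform bound for the partial sums of the expansion near the real axis. -/
theorem exists_norm_partialSum_le (h : IsTwistedForm κ β C g) {ε : ℝ} (hε : 0 < ε) (hε1 : ε < 1) :
    ∃ D : ℝ, ∀ (N : ℕ) (x t : ℝ), 0 < t → t ≤ 1 →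
      ‖∑ n ∈ Finset.range N, twistedCoef κ g n *
        Complex.exp (2 * Real.pi * Complex.I * (n + κ : ℝ) * (x + t * Complex.I))‖ ≤
      D * t ^ (-(β + ε)) := by
  -- The integrand is integrable at 0 precisely because ε > 0. The factor 2^β in the constant comes
  -- from evaluating g at height t/2.
  set M := ∫ v in (-(1 / 2) : ℝ)..(1 / 2), |v| ^ (ε - 1) with hM
  refine ⟨C * 2 ^ β * (2 * Real.exp Real.pi) * M, fun N x t ht ht1 => ?_⟩
  have ht2 : 0 < t / 2 := by positivity
  have hcont : Continuous fun v : ℝ => g (ofComplex ((x + v : ℝ) + (t / 2 : ℝ) * Complex.I)) :=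
    (continuous_horizontal h.holo ht2).comp (continuous_const.add continuous_id)
  have hS : ∑ n ∈ Finset.range N, twistedCoef κ g n *
        Complex.exp (2 * Real.pi * Complex.I * (n + κ : ℝ) * (x + t * Complex.I))
      = ∫ v in (-(1 / 2) : ℝ)..(1 / 2), g (ofComplex ((x + v : ℝ) + (t / 2 : ℝ) * Complex.I)) *
        ∑ n ∈ Finset.range N, Complex.exp
          (2 * Real.pi * Complex.I * (n + κ : ℝ) * (-v + (t / 2 : ℝ) * Complex.I)) := by
    simp_rw [Finset.mul_sum]
    rw [intervalIntegral.integral_finsetSum]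
    · exact Finset.sum_congr rfl fun n _ => h.coef_mul_exp_eq n x ht
    · intro n _
      apply Continuous.intervalIntegrable
      exact hcont.mul (by fun_prop)
  have hC := h.const_nonneg
  have hbd : ∀ᵐ v : ℝ, v ∈ Set.Ioc (-(1 / 2) : ℝ) (1 / 2) →
      ‖g (ofComplex ((x + v : ℝ) + (t / 2 : ℝ) * Complex.I)) *
        ∑ n ∈ Finset.range N, Complex.exp
          (2 * Real.pi * Complex.I * (n + κ : ℝ) * (-v + (t / 2 : ℝ) * Complex.I))‖ ≤
      C * 2 ^ β * (2 * Real.exp Real.pi) * t ^ (-(β + ε)) * |v| ^ (ε - 1) := by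
    have h0 : ∀ᵐ v : ℝ, v ≠ 0 := by simp [ae_iff, measure_singleton]
    filter_upwards [h0] with v hv hvI
    have hva : |v| ≤ 1 / 2 := abs_le.2 ⟨hvI.1.le, hvI.2⟩
    have hb := h.bound (ofComplex ((x + v : ℝ) + (t / 2 : ℝ) * Complex.I))
    rw [im_ofComplex_add ht2] at hb
    rw [norm_mul]
    calc _ ≤ (C * (t / 2) ^ (-β)) * (2 * Real.exp Real.pi * t ^ (-ε) * |v| ^ (ε - 1)) := by
          gcongr
          exact norm_sum_exp_le h.nonneg ht ht1 hva hv hε hε1 N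
      _ = _ := by
          rw [Real.div_rpow ht.le (by norm_num), neg_add, Real.rpow_add ht,
            Real.rpow_neg (by norm_num : (0 : ℝ) ≤ 2), div_inv_eq_mul]
          ring
  rw [hS]
  refine (intervalIntegral.norm_integral_le_of_norm_le (by norm_num) hbd
    ((intervalIntegrable_abs_rpow (by linarith) _ _).const_mul _)).trans ?_
  rw [intervalIntegral.integral_const_mul, ← hM]
  exact le_of_eq (by ring)

/-- Uniform exponential bound for the partial sums of the expansion near infinity. -/
theorem exists_norm_partialSum_le_exp (h : IsTwistedForm κ β C g) :
    ∃ D δ : ℝ, 0 < δ ∧ ∀ (N : ℕ) (x t : ℝ), 1 ≤ t →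
      ‖∑ n ∈ Finset.range N, twistedCoef κ g n *
        Complex.exp (2 * Real.pi * Complex.I * (n + κ : ℝ) * (x + t * Complex.I))‖ ≤
      D * Real.exp (-δ * t) := by
  obtain ⟨δ, hδ, hfreq⟩ := h.exists_freq_bound
  have hsum := (h.hasSum UpperHalfPlane.I).summable.norm
  have hn : ∀ (n : ℕ) (x t : ℝ), ‖twistedCoef κ g n *
      Complex.exp (2 * Real.pi * Complex.I * (n + κ : ℝ) * (x + t * Complex.I))‖
      = ‖twistedCoef κ g n‖ * Real.exp (-(2 * Real.pi * (n + κ) * t)) := fun n x t => by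
    rw [norm_mul, norm_exp_mul_coe]
    simp
  have hsum' : Summable fun n : ℕ =>
      ‖twistedCoef κ g n‖ * Real.exp (-(2 * Real.pi * (n + κ) * 1)) := by
    refine hsum.congr fun n => ?_
    rw [← hn n 0 1]
    simp
  -- For t ≥ 1 each nonzero term is at most its size at height 1 times exp(-2πδ(t - 1)), with δ the
  -- lower bound for the frequencies. Absolute convergence at z = i sums these, and exp(2πδ) absorbs
  -- the shift from t to t - 1.
  refine ⟨(∑' n : ℕ, ‖twistedCoef κ g n‖ * Real.exp (-(2 * Real.pi * (n + κ) * 1)))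
    * Real.exp (2 * Real.pi * δ), 2 * Real.pi * δ, by positivity, fun N x t ht => ?_⟩
  refine (norm_sum_le _ _).trans ?_
  calc _ ≤ ∑ n ∈ Finset.range N, ‖twistedCoef κ g n‖ * Real.exp (-(2 * Real.pi * (n + κ) * 1))
        * (Real.exp (2 * Real.pi * δ) * Real.exp (-(2 * Real.pi * δ) * t)) := by
        refine Finset.sum_le_sum fun n _ => ?_
        rw [hn]
        rcases hfreq n with h0 | h1
        · simp [h0]
        · rw [mul_assoc ‖_‖, ← Real.exp_add, ← Real.exp_add]
          gcongr
          nlinarith [Real.pi_pos, mul_nonneg (mul_nonneg Real.pi_pos.le (sub_nonneg.2 h1))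
            (sub_nonneg.2 ht)]
    _ ≤ _ := by
        rw [← Finset.sum_mul]
        exact (mul_le_mul_of_nonneg_right (hsum'.sum_le_tsum _ fun n _ => by positivity)
          (by positivity)).trans (le_of_eq (by ring))

theorem tendsto_partialSum (h : IsTwistedForm κ β C g) (x : ℝ) {t : ℝ} (ht : 0 < t) :
    Tendsto (fun N : ℕ => ∑ n ∈ Finset.range N, twistedCoef κ g n *
        Complex.exp (2 * Real.pi * Complex.I * (n + κ : ℝ) * (x + t * Complex.I))) atTop
      (𝓝 (g (ofComplex (x + t * Complex.I)))) := by
  have := (h.hasSum (ofComplex (x + t * Complex.I))).tendsto_sum_nat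
  simpa only [coe_ofComplex_add ht] using this

/-- A twisted form decays exponentially at infinity. -/
theorem exists_norm_le_exp (h : IsTwistedForm κ β C g) :
    ∃ D δ : ℝ, 0 < δ ∧ ∀ z : ℍ, 1 ≤ z.im → ‖g z‖ ≤ D * Real.exp (-δ * z.im) := by
  obtain ⟨D, δ, hδ, hD⟩ := h.exists_norm_partialSum_le_exp
  refine ⟨D, δ, hδ, fun z hz => ?_⟩
  have h1 := h.tendsto_partialSum z.re z.im_pos
  have h2 : (z.re : ℂ) + z.im * Complex.I = z := by
    apply Complex.ext <;> simp
  rw [h2, ofComplex_apply] at h1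
  refine le_of_tendsto h1.norm (Eventually.of_forall fun N => ?_)
  have := hD N z.re z.im hz
  rwa [h2] at this

/-! ### Convergence of the fractional integral to a Mellin transform -/

/-- An integrable majorant. -/
theorem integrableOn_majorant {a b D E δ : ℝ} (hab : -1 < a - b) (hδ : 0 < δ) :
    IntegrableOn (fun t : ℝ => if t ≤ 1 then t ^ a * (D * t ^ (-b))
      else t ^ a * (E * Real.exp (-δ * t))) (Set.Ioi 0) := by
  rw [← Set.Ioc_union_Ioi_eq_Ioi (zero_le_one' ℝ), integrableOn_union]
  constructor
  · have h1 : IntegrableOn (fun t : ℝ => D * t ^ (a - b)) (Set.Ioc 0 1) :=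
      ((intervalIntegrable_iff_integrableOn_Ioc_of_le zero_le_one).1
        (intervalIntegral.intervalIntegrable_rpow' hab)).const_mul D
    refine h1.congr_fun (fun t ht => ?_) measurableSet_Ioc
    simp only [ht.2, if_true]
    rw [sub_eq_add_neg, Real.rpow_add ht.1]
    ring
  -- Replacing a by |a| only enlarges the integrand for t ≥ 1 and makes the comparison function
  -- integrable at 0 for every a.
  · have h1 : IntegrableOn (fun t : ℝ => t ^ |a| * Real.exp (-δ * t ^ (1 : ℝ))) (Set.Ioi 0) :=
      integrableOn_rpow_mul_exp_neg_mul_rpow (by have := abs_nonneg a; linarith) one_pos hδ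
    have h2 : IntegrableOn (fun t : ℝ => |E| * (t ^ |a| * Real.exp (-δ * t ^ (1 : ℝ))))
        (Set.Ioi 1) := (h1.mono_set (Set.Ioi_subset_Ioi zero_le_one)).const_mul _
    have h3 : IntegrableOn (fun t : ℝ => t ^ a * (E * Real.exp (-δ * t))) (Set.Ioi 1) := by
      refine Integrable.mono' h2 ?_ ?_
      · refine ContinuousOn.aestronglyMeasurable (fun t ht => ?_) measurableSet_Ioi
        have ht0 : t ≠ 0 := (zero_lt_one.trans ht).ne'
        exact ((Real.continuousAt_rpow_const _ _ (Or.inl ht0)).mul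
          (by fun_prop)).continuousWithinAt
      · refine (ae_restrict_iff' measurableSet_Ioi).2 (Eventually.of_forall fun t ht => ?_)
        have ht1 : (1 : ℝ) ≤ t := le_of_lt ht
        rw [norm_mul, norm_mul, Real.norm_of_nonneg (Real.exp_pos _).le, Real.norm_eq_abs,
          Real.norm_eq_abs, abs_of_nonneg (Real.rpow_nonneg (by linarith) _), Real.rpow_one,
          mul_left_comm]
        gcongr
        exact le_abs_self a
    refine h3.congr_fun (fun t ht => ?_) measurableSet_Ioi
    simp [not_le.2 (show (1 : ℝ) < t from ht)]

/-- The partial sums of the fractional integral converge to a Mellin transform. -/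
theorem tendsto_fracSum (h : IsTwistedForm κ β C g) {α : ℝ} (hα : β < α) (x : ℝ) :
    IntegrableOn (fun t : ℝ => ((t ^ (α - 1) : ℝ) : ℂ) * g (ofComplex (x + t * Complex.I)))
      (Set.Ioi 0) ∧
    Tendsto (fun N : ℕ => ∑ n ∈ Finset.range N, if 0 < (n : ℝ) + κ then
        twistedCoef κ g n / (((n + κ) ^ α : ℝ) : ℂ) *
          Complex.exp (2 * Real.pi * Complex.I * (n + κ : ℝ) * x) else 0) atTop
      (𝓝 ((((2 * Real.pi) ^ α / Real.Gamma α : ℝ) : ℂ) *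
        ∫ t in Set.Ioi (0 : ℝ), ((t ^ (α - 1) : ℝ) : ℂ) * g (ofComplex (x + t * Complex.I)))) := by
  set S : ℕ → ℝ → ℂ := fun N t => ∑ n ∈ Finset.range N, twistedCoef κ g n *
    Complex.exp (2 * Real.pi * Complex.I * (n + κ : ℝ) * (x + t * Complex.I)) with hS
  have hα0 : 0 < α := h.pos.trans hα
  -- The majorant behaves like t^(α-1-β-ε) near 0, so integrability needs ε < α - β; the kernel
  -- bound needs ε < 1.
  set ε := min (1 / 2) ((α - β) / 2) with hεdef
  have hε : 0 < ε := lt_min (by norm_num) (by linarith)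
  have hε1 : ε < 1 := (min_le_left _ _).trans_lt (by norm_num)
  have hε2 : ε < α - β := (min_le_right _ _).trans_lt (by linarith)
  obtain ⟨D, hD⟩ := h.exists_norm_partialSum_le hε hε1
  obtain ⟨E, δ, hδ, hE⟩ := h.exists_norm_partialSum_le_exp
  set maj : ℝ → ℝ := fun t => if t ≤ 1 then t ^ (α - 1) * (D * t ^ (-(β + ε)))
      else t ^ (α - 1) * (E * Real.exp (-δ * t)) with hmaj
  have hmajint : IntegrableOn maj (Set.Ioi 0) := integrableOn_majorant (by linarith) hδ
  have hrc : ContinuousOn (fun t : ℝ => ((t ^ (α - 1) : ℝ) : ℂ)) (Set.Ioi 0) := fun t ht =>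
    (Complex.continuous_ofReal.continuousAt.comp
      (Real.continuousAt_rpow_const t _ (Or.inl (ne_of_gt ht)))).continuousWithinAt
  have hSc : ∀ N, Continuous (S N) := fun N => by
    simp only [hS]
    fun_prop
  have hmeasS : ∀ N, AEStronglyMeasurable (fun t : ℝ => ((t ^ (α - 1) : ℝ) : ℂ) * S N t)
      (volume.restrict (Set.Ioi 0)) := fun N =>
    (hrc.mul (hSc N).continuousOn).aestronglyMeasurable measurableSet_Ioi
  have hSb : ∀ N, ∀ᵐ t : ℝ ∂(volume.restrict (Set.Ioi 0)),
      ‖((t ^ (α - 1) : ℝ) : ℂ) * S N t‖ ≤ maj t := fun N => by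
    refine (ae_restrict_iff' measurableSet_Ioi).2 (Eventually.of_forall fun t ht => ?_)
    have ht0 : 0 < t := ht
    rw [norm_mul, Complex.norm_real, Real.norm_of_nonneg (Real.rpow_nonneg ht0.le _)]
    simp only [hmaj]
    split_ifs with h1
    · gcongr
      exact hD N x t ht0 h1
    · gcongr
      exact hE N x t (not_le.1 h1).le
  have hlim : ∀ᵐ t : ℝ ∂(volume.restrict (Set.Ioi 0)), Tendsto
      (fun N => ((t ^ (α - 1) : ℝ) : ℂ) * S N t) atTop
      (𝓝 (((t ^ (α - 1) : ℝ) : ℂ) * g (ofComplex (x + t * Complex.I)))) := by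
    refine (ae_restrict_iff' measurableSet_Ioi).2 (Eventually.of_forall fun t ht => ?_)
    exact (h.tendsto_partialSum x ht).const_mul _
  have hdom := tendsto_integral_of_dominated_convergence maj hmeasS hmajint hSb hlim
  refine ⟨?_, ?_⟩
  · refine Integrable.mono' hmajint
      ((hrc.mul (continuousOn_vertical h.holo x)).aestronglyMeasurable measurableSet_Ioi) ?_
    filter_upwards [hlim, ae_all_iff.2 hSb] with t h1 h2
    exact le_of_tendsto h1.norm (Eventually.of_forall h2)
  · have hterm : ∀ n : ℕ, IntegrableOn (fun t : ℝ => ((t ^ (α - 1) : ℝ) : ℂ) *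
        (twistedCoef κ g n *
          Complex.exp (2 * Real.pi * Complex.I * (n + κ : ℝ) * (x + t * Complex.I))))
        (Set.Ioi 0) ∧ (((2 * Real.pi) ^ α / Real.Gamma α : ℝ) : ℂ) *
        (∫ t in Set.Ioi (0 : ℝ), ((t ^ (α - 1) : ℝ) : ℂ) * (twistedCoef κ g n *
          Complex.exp (2 * Real.pi * Complex.I * (n + κ : ℝ) * (x + t * Complex.I))))
        = if 0 < (n : ℝ) + κ then twistedCoef κ g n / (((n + κ) ^ α : ℝ) : ℂ) *
          Complex.exp (2 * Real.pi * Complex.I * (n + κ : ℝ) * x) else 0 := by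
      intro n
      by_cases hn : 0 < (n : ℝ) + κ
      · set b := 2 * Real.pi * (n + κ) with hb
        have hb0 : 0 < b := by positivity
        have hfun : ∀ t : ℝ, ((t ^ (α - 1) : ℝ) : ℂ) * (twistedCoef κ g n *
          Complex.exp (2 * Real.pi * Complex.I * (n + κ : ℝ) * (x + t * Complex.I)))
          = (twistedCoef κ g n * Complex.exp (2 * Real.pi * Complex.I * (n + κ : ℝ) * x)) *
            ((t ^ (α - 1) * Real.exp (-(b * t)) : ℝ) : ℂ) := fun t => by
          have : Complex.exp (2 * Real.pi * Complex.I * (n + κ : ℝ) * (x + t * Complex.I))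
            = Complex.exp (2 * Real.pi * Complex.I * (n + κ : ℝ) * x) *
              ((Real.exp (-(b * t)) : ℝ) : ℂ) := by
            rw [Complex.ofReal_exp, ← Complex.exp_add]
            congr 1
            rw [hb]
            push_cast
            linear_combination (2 * Real.pi * (n + κ) * t : ℂ) * Complex.I_sq
          rw [this]
          push_cast
          ring
        have hint : IntegrableOn (fun t : ℝ => t ^ (α - 1) * Real.exp (-(b * t))) (Set.Ioi 0) := by
          have := integrableOn_rpow_mul_exp_neg_mul_rpow (s := α - 1) (p := 1) (by linarith)
            one_pos hb0
          simpa only [Real.rpow_one, neg_mul] using this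
        simp_rw [hfun]
        refine ⟨(Integrable.ofReal hint).const_mul _, ?_⟩
        rw [integral_const_mul, integral_complex_ofReal,
          Real.integral_rpow_mul_exp_neg_mul_Ioi hα0 hb0, if_pos hn, hb, one_div,
          Real.inv_rpow (by positivity), Real.mul_rpow (by positivity) hn.le]
        have hG : Real.Gamma α ≠ 0 := (Real.Gamma_pos_of_pos hα0).ne'
        have hp : (2 * Real.pi) ^ α ≠ 0 := (Real.rpow_pos_of_pos (by positivity) _).ne'
        have hk : ((n : ℝ) + κ) ^ α ≠ 0 := (Real.rpow_pos_of_pos hn _).ne'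
        have hreal : (2 * Real.pi) ^ α / Real.Gamma α * (((2 * Real.pi) ^ α * (n + κ) ^ α)⁻¹
            * Real.Gamma α) = ((n + κ) ^ α)⁻¹ := by
          field_simp
        rw [mul_left_comm, ← Complex.ofReal_mul, hreal, Complex.ofReal_inv]
        ring
      -- The frequency 0 is left out of the series, where (n + κ)^α in the denominator would vanish.
      -- It contributes nothing to the integral either, since its coefficient is zero.
      · have hn0 : (n : ℝ) + κ = 0 :=
          le_antisymm (not_lt.1 hn) (add_nonneg (Nat.cast_nonneg _) h.nonneg)
        have hκ0 : κ = 0 := by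
          have := h.nonneg
          have : (0 : ℝ) ≤ n := Nat.cast_nonneg _
          linarith
        have hnn : n = 0 := by
          rw [hκ0, add_zero] at hn0
          exact_mod_cast hn0
        rw [if_neg hn, hnn, h.coef_zero hκ0]
        simp
    refine (hdom.const_mul _).congr fun N => ?_
    simp only [hS, Finset.mul_sum]
    rw [integral_finsetSum _ fun n _ => (hterm n).1, Finset.mul_sum]
    exact Finset.sum_congr rfl fun n _ => (hterm n).2

end IsTwistedForm

/-! ### Complex powers -/

theorem mul_cpow_of_arg_add_mem {a b : ℂ} (ha : a ≠ 0) (hb : b ≠ 0)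
    (h : a.arg + b.arg ∈ Set.Ioc (-Real.pi) Real.pi) (s : ℂ) : (a * b) ^ s = a ^ s * b ^ s := by
  rw [Complex.cpow_def_of_ne_zero (mul_ne_zero ha hb), Complex.cpow_def_of_ne_zero ha,
    Complex.cpow_def_of_ne_zero hb, ← Complex.exp_add,
    (Complex.log_mul_eq_add_log_iff ha hb).2 h, add_mul]

theorem ne_zero_of_im_pos {a : ℂ} (ha : 0 < a.im) : a ≠ 0 := by
  rintro rfl
  simp at ha

theorem ne_zero_of_im_neg {a : ℂ} (ha : a.im < 0) : a ≠ 0 := by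
  rintro rfl
  simp at ha

/-- The arguments lie in (0, π] and (-π, 0), so their sum never leaves the principal range. This is
where the sign condition c < 0 on scaling matrices pays off: automorphy factors lie in the lower
half-plane. -/
theorem mul_cpow_of_im_pos_of_im_neg {a b : ℂ} (ha : 0 < a.im) (hb : b.im < 0) (s : ℂ) :
    (a * b) ^ s = a ^ s * b ^ s := by
  refine mul_cpow_of_arg_add_mem (ne_zero_of_im_pos ha) (ne_zero_of_im_neg hb) ?_ s
  have h1 : 0 < a.arg := by
    refine lt_of_le_of_ne (Complex.arg_nonneg_iff.2 ha.le) fun h => ?_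
    have := (Complex.arg_eq_zero_iff.1 h.symm).2
    exact ha.ne' this
  have h2 : b.arg < 0 := Complex.arg_neg_iff.2 hb
  have h3 := Complex.arg_le_pi a
  have h4 := Complex.neg_pi_lt_arg b
  exact ⟨by linarith, by linarith⟩

theorem neg_cpow_of_im_pos {a : ℂ} (ha : 0 < a.im) (s : ℂ) :
    (-a) ^ s = Complex.exp (-(Real.pi * Complex.I * s)) * a ^ s := by
  have h0 := ne_zero_of_im_pos ha
  rw [Complex.cpow_def_of_ne_zero (neg_ne_zero.2 h0), Complex.cpow_def_of_ne_zero h0,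
    ← Complex.exp_add]
  congr 1
  rw [Complex.log, Complex.log, Complex.arg_neg_eq_arg_sub_pi_of_im_pos ha, norm_neg]
  push_cast
  ring

theorem neg_cpow_of_im_neg {a : ℂ} (ha : a.im < 0) (s : ℂ) :
    (-a) ^ s = Complex.exp (Real.pi * Complex.I * s) * a ^ s := by
  have h0 := ne_zero_of_im_neg ha
  rw [Complex.cpow_def_of_ne_zero (neg_ne_zero.2 h0), Complex.cpow_def_of_ne_zero h0,
    ← Complex.exp_add]
  congr 1
  rw [Complex.log, Complex.log, Complex.arg_neg_eq_arg_add_pi_of_im_neg ha, norm_neg]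
  push_cast
  ring

/-! ### Automorphy factors -/

theorem coe_smul_real (g : SL(2, ℝ)) (z : ℍ) :
    ((g • z : ℍ) : ℂ) = (g 0 0 * z + g 0 1) / autFactor g z :=
  coe_specialLinearGroup_apply g z

theorem toReal_apply (γ : SL(2, ℤ)) (i j : Fin 2) : toReal γ i j = (γ i j : ℝ) := rfl

theorem toReal_mul (γ δ : SL(2, ℤ)) : toReal (γ * δ) = toReal γ * toReal δ := map_mul _ _ _

theorem toReal_smul (γ : SL(2, ℤ)) (z : ℍ) : toReal γ • z = γ • z := by
  ext
  rw [coe_specialLinearGroup_apply, coe_specialLinearGroup_apply]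
  rfl

theorem autFactor_eq_denom (g : SL(2, ℝ)) (z : ℍ) :
    autFactor g z = denom (SpecialLinearGroup.mapGL ℝ g) z := rfl

theorem autFactor_ne_zero (g : SL(2, ℝ)) (z : ℍ) : autFactor g z ≠ 0 := by
  rw [autFactor_eq_denom]
  exact denom_ne_zero _ z

theorem im_autFactor (g : SL(2, ℝ)) (z : ℍ) : (autFactor g z).im = g 1 0 * z.im := by
  simp [autFactor]

theorem autFactor_mul (g h : SL(2, ℝ)) (z : ℍ) :
    autFactor (g * h) z = autFactor g (h • z) * autFactor h z := by
  have h0 := autFactor_ne_zero h z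
  have hm : ∀ i j, (g * h) i j = g i 0 * h 0 j + g i 1 * h 1 j := fun i j => by
    rw [Matrix.SpecialLinearGroup.coe_mul, Matrix.mul_apply, Fin.sum_univ_two]
  have e : autFactor g (h • z) = g 1 0 * ((h • z : ℍ) : ℂ) + g 1 1 := rfl
  rw [e, coe_smul_real, add_mul, mul_assoc, div_mul_cancel₀ _ h0]
  simp only [autFactor, hm]
  push_cast
  ring

theorem im_smul_real (g : SL(2, ℝ)) (z : ℍ) : (g • z).im = z.im / ‖autFactor g z‖ ^ 2 := by
  have := UpperHalfPlane.im_smul_eq_div_normSq (SpecialLinearGroup.mapGL ℝ g) z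
  rw [← Complex.normSq_eq_norm_sq, autFactor_eq_denom]
  simp only [Matrix.SpecialLinearGroup.det_mapGL, Units.val_one, abs_one, one_mul] at this
  exact this

/-- The factor |j|^(-r) of the slash operator matches Im(gz) = Im z / |j|^2. Bounds on |f| (Im
z)^(r/2) therefore pass between f and all its slashes with the same constant. -/
theorem norm_slash (r : ℝ) (g : SL(2, ℝ)) (f : ℍ → ℂ) (z : ℍ) :
    ‖slash r g f z‖ * z.im ^ (r / 2) = ‖f (g • z)‖ * (g • z).im ^ (r / 2) := by
  have h0 : 0 < ‖autFactor g z‖ := norm_pos_iff.2 (autFactor_ne_zero g z)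
  rw [slash, norm_div, Complex.norm_cpow_real, im_smul_real,
    Real.div_rpow z.im_pos.le (by positivity), ← Real.rpow_natCast, ← Real.rpow_mul h0.le]
  rw [show ((2 : ℕ) : ℝ) * (r / 2) = r by push_cast; ring]
  ring

theorem norm_mul_im_rpow_invariant {Γ : Subgroup SL(2, ℤ)} {r : ℝ} {mu : SL(2, ℤ) → ℂ} {f : ℍ → ℂ}
    (hf : IsModularForm Γ r mu f) {γ : SL(2, ℤ)} (hγ : γ ∈ Γ) (z : ℍ) :
    ‖f (γ • z)‖ * (γ • z).im ^ (r / 2) = ‖f z‖ * z.im ^ (r / 2) := by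
  have h0 : 0 < ‖autFactor (toReal γ) z‖ := norm_pos_iff.2 (autFactor_ne_zero _ z)
  rw [← toReal_smul, ← norm_slash, slash, toReal_smul, hf.law γ hγ, norm_div, norm_mul, norm_mul,
    hf.unimodular γ hγ, one_mul, mul_div_cancel_left₀]
  rw [Complex.norm_cpow_real]
  positivity

/-! ### Cusp stabilizers and widths -/

theorem smul_infty_eq_iff (γ : SL(2, ℤ)) :
    SpecialLinearGroup.mapGL ℚ γ • (OnePoint.infty : OnePoint ℚ) = OnePoint.infty ↔
      γ 1 0 = 0 := by
  rw [OnePoint.smul_infty_eq_self_iff]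
  simp

theorem mem_cuspStabilizer_iff (γ s : SL(2, ℤ)) :
    s ∈ cuspStabilizer (SpecialLinearGroup.mapGL ℚ γ • (OnePoint.infty : OnePoint ℚ)) ↔
      (γ⁻¹ * s * γ) 1 0 = 0 := by
  rw [← smul_infty_eq_iff, cuspStabilizer, Subgroup.mem_comap, MulAction.mem_stabilizer_iff,
    map_mul, map_mul, mul_smul, mul_smul, map_inv, inv_smul_eq_iff]

theorem commute_of_apply_one_zero_eq_zero {a b : SL(2, ℤ)} (ha : a 1 0 = 0) (hb : b 1 0 = 0) :
    a * b = b * a := by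
  have ha1 := a.det_coe
  have hb1 := b.det_coe
  rw [Matrix.det_fin_two, ha, mul_zero, sub_zero] at ha1
  rw [Matrix.det_fin_two, hb, mul_zero, sub_zero] at hb1
  have ha2 := Int.eq_of_mul_eq_one ha1
  have hb2 := Int.eq_of_mul_eq_one hb1
  ext i j
  fin_cases i <;> fin_cases j <;>
    simp [Matrix.SpecialLinearGroup.coe_mul, Matrix.mul_apply, Fin.sum_univ_two, ha, hb, ha2, hb2] <;> ring

/-- The stabilizer of a cusp is conjugate to the abelian group of integral upper triangular
matrices. Normality ensures that the power of an element given by the index falls into the subgroup,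
which identifies the width with a translation length. -/
theorem normal_subgroupOf_cuspStabilizer (H : Subgroup SL(2, ℤ)) (γ : SL(2, ℤ)) :
    (H.subgroupOf (cuspStabilizer
      (SpecialLinearGroup.mapGL ℚ γ • (OnePoint.infty : OnePoint ℚ)))).Normal := by
  refine ⟨fun n hn g => ?_⟩
  have hcomm : g * n = n * g := by
    have h := commute_of_apply_one_zero_eq_zero ((mem_cuspStabilizer_iff γ _).1 g.2)
      ((mem_cuspStabilizer_iff γ _).1 n.2)
    apply Subtype.ext
    have h1 : γ * ((γ⁻¹ * g.1 * γ) * (γ⁻¹ * n.1 * γ)) * γ⁻¹ = g.1 * n.1 := by group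
    have h2 : γ * ((γ⁻¹ * n.1 * γ) * (γ⁻¹ * g.1 * γ)) * γ⁻¹ = n.1 * g.1 := by group
    rw [Subgroup.coe_mul, Subgroup.coe_mul, ← h1, ← h2, h]
  rwa [hcomm, mul_inv_cancel_right]

theorem cuspWidth_pos (Γ : Subgroup SL(2, ℤ)) [Γ.FiniteIndex] (𝔞 : OnePoint ℚ) :
    0 < cuspWidth Γ 𝔞 := by
  have : (Γ ⊔ Subgroup.zpowers (-1)).FiniteIndex := Subgroup.finiteIndex_of_le le_sup_left
  exact Nat.pos_of_ne_zero (Subgroup.FiniteIndex.index_ne_zero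
    (H := (Γ ⊔ Subgroup.zpowers (-1)).subgroupOf (cuspStabilizer 𝔞)))

theorem mem_or_neg_mem_of_mem_sup {Γ : Subgroup SL(2, ℤ)} {δ : SL(2, ℤ)}
    (h : δ ∈ Γ ⊔ Subgroup.zpowers (-1)) : δ ∈ Γ ∨ -δ ∈ Γ := by
  have : (Subgroup.zpowers (-1 : SL(2, ℤ))).Normal := by
    refine ⟨fun n hn g => ?_⟩
    obtain ⟨k, rfl⟩ := Subgroup.mem_zpowers_iff.1 hn
    have : Commute g ((-1 : SL(2, ℤ)) ^ k) := (Commute.neg_one_right g).zpow_right k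
    rw [this.eq, mul_inv_cancel_right]
    exact hn
  obtain ⟨y, hy, z, hz, rfl⟩ := Subgroup.mem_sup_of_normal_right.1 h
  obtain ⟨k, rfl⟩ := Subgroup.mem_zpowers_iff.1 hz
  rcases Int.even_or_odd k with hk | hk
  · left
    rw [hk.neg_one_zpow]
    simpa using hy
  · right
    rw [hk.neg_one_zpow]
    simpa using hy

/-- The parabolic element generating the translations by the width at a cusp. -/
def parabolic (γ : SL(2, ℤ)) (m : ℕ) : SL(2, ℤ) := γ * ModularGroup.T ^ m * γ⁻¹

theorem parabolic_mem_or (Γ : Subgroup SL(2, ℤ)) (γ : SL(2, ℤ)) :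
    parabolic γ (cuspWidth Γ (SpecialLinearGroup.mapGL ℚ γ • OnePoint.infty)) ∈ Γ ∨
    -parabolic γ (cuspWidth Γ (SpecialLinearGroup.mapGL ℚ γ • OnePoint.infty)) ∈ Γ := by
  apply mem_or_neg_mem_of_mem_sup
  set 𝔞 : OnePoint ℚ := SpecialLinearGroup.mapGL ℚ γ • OnePoint.infty with h𝔞
  have := normal_subgroupOf_cuspStabilizer (Γ ⊔ Subgroup.zpowers (-1)) γ
  have hmem : γ * ModularGroup.T * γ⁻¹ ∈ cuspStabilizer 𝔞 := by
    rw [h𝔞, mem_cuspStabilizer_iff, show γ⁻¹ * (γ * ModularGroup.T * γ⁻¹) * γ = ModularGroup.T by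
      group]
    simp [ModularGroup.T]
  have h := Subgroup.pow_index_mem ((Γ ⊔ Subgroup.zpowers (-1)).subgroupOf (cuspStabilizer 𝔞))
    ⟨_, hmem⟩
  rw [Subgroup.mem_subgroupOf] at h
  rw [parabolic, ← conj_pow]
  exact h

theorem coe_T_pow (m : ℕ) : ((ModularGroup.T ^ m : SL(2, ℤ)) : Matrix (Fin 2) (Fin 2) ℤ)
    = !![1, (m : ℤ); 0, 1] := by
  rw [← ModularGroup.coe_T_zpow, zpow_natCast]

theorem parabolic_apply_one_zero (γ : SL(2, ℤ)) (m : ℕ) :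
    parabolic γ m 1 0 = -(γ 1 0 ^ 2 * m) := by
  have hd := γ.det_coe
  rw [Matrix.det_fin_two] at hd
  simp only [parabolic, Matrix.SpecialLinearGroup.coe_mul, coe_T_pow, Matrix.SpecialLinearGroup.coe_inv,
    Matrix.adjugate_fin_two, Matrix.mul_apply, Fin.sum_univ_two]
  simp
  ring

theorem parabolic_apply_one_one (γ : SL(2, ℤ)) (m : ℕ) :
    parabolic γ m 1 1 = 1 + γ 0 0 * γ 1 0 * m := by
  have hd := γ.det_coe
  rw [Matrix.det_fin_two] at hd
  simp only [parabolic, Matrix.SpecialLinearGroup.coe_mul, coe_T_pow, Matrix.SpecialLinearGroup.coe_inv,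
    Matrix.adjugate_fin_two, Matrix.mul_apply, Fin.sum_univ_two]
  simp
  linear_combination hd

/-! ### Scaling matrices -/

/-- `σ = γ (√m, 0; 0, 1 / √m)`. -/
structure IsScaling (γ : SL(2, ℤ)) (m : ℕ) (σ : SL(2, ℝ)) : Prop where
  pos : 0 < m
  normalized : γ 1 0 < 0 ∨ (γ 1 0 = 0 ∧ γ 1 1 = 1)
  coe_eq : (σ : Matrix (Fin 2) (Fin 2) ℝ) = (toReal γ : Matrix (Fin 2) (Fin 2) ℝ) *
      !![√(m : ℝ), 0; 0, 1 / √(m : ℝ)]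

namespace IsScaling

variable {γ : SL(2, ℤ)} {m : ℕ} {σ : SL(2, ℝ)}

theorem sqrt_pos (h : IsScaling γ m σ) : 0 < √(m : ℝ) :=
  Real.sqrt_pos.2 (by exact_mod_cast h.pos)

theorem apply_zero (h : IsScaling γ m σ) (i : Fin 2) : σ i 0 = γ i 0 * √(m : ℝ) := by
  have := congr_fun (congr_fun h.coe_eq i) 0
  simpa [Matrix.mul_apply, Fin.sum_univ_two, toReal_apply] using this

theorem apply_one (h : IsScaling γ m σ) (i : Fin 2) : σ i 1 = γ i 1 / √(m : ℝ) := by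
  have := congr_fun (congr_fun h.coe_eq i) 1
  simpa [Matrix.mul_apply, Fin.sum_univ_two, toReal_apply, div_eq_mul_inv] using this

/-- The diagonal part of σ conjugates T to T^m, so translation by 1 in the coordinate of σ is the
parabolic element of width m at the cusp. -/
theorem mul_T (h : IsScaling γ m σ) :
    σ * toReal ModularGroup.T = toReal (parabolic γ m) * σ := by
  have hs := h.sqrt_pos.ne'
  have hss : √(m : ℝ) * √(m : ℝ) = m := Real.mul_self_sqrt (Nat.cast_nonneg _)
  have h1 : toReal (parabolic γ m) * toReal γ = toReal γ * toReal (ModularGroup.T ^ m) := by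
    rw [← toReal_mul, ← toReal_mul, parabolic, inv_mul_cancel_right]
  apply Subtype.ext
  change (σ : Matrix (Fin 2) (Fin 2) ℝ) * (toReal ModularGroup.T : Matrix (Fin 2) (Fin 2) ℝ)
    = (toReal (parabolic γ m) : Matrix (Fin 2) (Fin 2) ℝ) * (σ : Matrix (Fin 2) (Fin 2) ℝ)
  have h1' := congr_arg (fun g : SL(2, ℝ) => (g : Matrix (Fin 2) (Fin 2) ℝ)) h1
  simp only [Matrix.SpecialLinearGroup.coe_mul] at h1'
  rw [h.coe_eq, ← Matrix.mul_assoc, h1', Matrix.mul_assoc, Matrix.mul_assoc]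
  congr 1
  have hT : (toReal ModularGroup.T : Matrix (Fin 2) (Fin 2) ℝ) = !![1, 1; 0, 1] := by
    ext i j
    rw [toReal_apply]
    fin_cases i <;> fin_cases j <;> simp [ModularGroup.T]
  have hTm : (toReal (ModularGroup.T ^ m) : Matrix (Fin 2) (Fin 2) ℝ) = !![1, (m : ℝ); 0, 1] := by
    ext i j
    rw [toReal_apply, coe_T_pow]
    fin_cases i <;> fin_cases j <;> simp
  rw [hT, hTm]
  ext i j
  fin_cases i <;> fin_cases j <;> simp [Matrix.mul_apply, Fin.sum_univ_two]
  field_simp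
  linarith

theorem smul_vadd (h : IsScaling γ m σ) (z : ℍ) :
    σ • ((1 : ℝ) +ᵥ z) = parabolic γ m • σ • z := by
  rw [← modular_T_smul, ← toReal_smul, ← toReal_smul, ← mul_smul, ← mul_smul, h.mul_T]

theorem autFactor_vadd (h : IsScaling γ m σ) (z : ℍ) :
    autFactor σ ((1 : ℝ) +ᵥ z) = autFactor (toReal (parabolic γ m)) (σ • z) * autFactor σ z := by
  rw [← autFactor_mul, ← h.mul_T, autFactor_mul, ← modular_T_smul, ← toReal_smul]
  have : autFactor (toReal ModularGroup.T) z = 1 := by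
    rw [autFactor, toReal_apply, toReal_apply]
    simp [ModularGroup.T]
  rw [this, mul_one]

theorem apply_one_zero_neg_or (h : IsScaling γ m σ) : σ 1 0 < 0 ∨ (σ 1 0 = 0 ∧ 0 < σ 1 1) := by
  rw [h.apply_zero, h.apply_one]
  rcases h.normalized with h1 | ⟨h1, h2⟩
  · left
    have : (γ 1 0 : ℝ) < 0 := by exact_mod_cast h1
    exact mul_neg_of_neg_of_pos this h.sqrt_pos
  · right
    rw [h1, h2]
    exact ⟨by simp, by have := h.sqrt_pos; positivity⟩

theorem autFactor_mem_slitPlane (h : IsScaling γ m σ) (z : ℍ) :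
    autFactor σ z ∈ Complex.slitPlane := by
  rcases h.apply_one_zero_neg_or with h1 | ⟨h1, h2⟩
  · right
    rw [im_autFactor]
    exact (mul_neg_of_neg_of_pos h1 z.im_pos).ne
  · left
    simpa [autFactor, h1] using h2

/-- The Möbius transformation of a scaling matrix. -/
theorem smul_eq (h : IsScaling γ m σ) (z : ℍ) {w : ℍ} (hw : (w : ℂ) = m * z) :
    σ • z = γ • w := by
  have hs : ((√(m : ℝ) : ℝ) : ℂ) ≠ 0 := by exact_mod_cast h.sqrt_pos.ne'
  have hss : ((√(m : ℝ) : ℝ) : ℂ) * ((√(m : ℝ) : ℝ) : ℂ) = m := by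
    rw [← Complex.ofReal_mul, Real.mul_self_sqrt (Nat.cast_nonneg _)]
    simp
  have hd := autFactor_ne_zero σ z
  have hd2 := autFactor_ne_zero (toReal γ) w
  apply UpperHalfPlane.ext
  rw [coe_smul_real, ← toReal_smul, coe_smul_real, div_eq_div_iff hd hd2]
  simp only [autFactor, toReal_apply, h.apply_zero, h.apply_one, hw]
  push_cast
  rw [← hss]
  field_simp

end IsScaling

theorem IsScalingMatrix.exists_isScaling {Γ : Subgroup SL(2, ℤ)} [Γ.FiniteIndex] {𝔞 : OnePoint ℚ}
    {σ : SL(2, ℝ)} (h : IsScalingMatrix Γ 𝔞 σ) :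
    ∃ γ : SL(2, ℤ), SpecialLinearGroup.mapGL ℚ γ • (OnePoint.infty : OnePoint ℚ) = 𝔞 ∧
      IsScaling γ (cuspWidth Γ 𝔞) σ := by
  obtain ⟨γ, h1, h2, h3⟩ := h
  exact ⟨γ, h1, cuspWidth_pos Γ 𝔞, h2, h3⟩

/-- The diagonal matrix `(√m, 0; 0, 1 / √m)`. -/
def scalingDiag (m : ℕ) (hm : 0 < m) : SL(2, ℝ) :=
  ⟨!![√(m : ℝ), 0; 0, 1 / √(m : ℝ)], by
    have : √(m : ℝ) ≠ 0 := (Real.sqrt_pos.2 (by exact_mod_cast hm)).ne'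
    simp [Matrix.det_fin_two, this]⟩

theorem exists_isScalingMatrix (Γ : Subgroup SL(2, ℤ)) [Γ.FiniteIndex] {γ : SL(2, ℤ)}
    (hγ : γ 1 0 < 0 ∨ (γ 1 0 = 0 ∧ γ 1 1 = 1)) {𝔞 : OnePoint ℚ}
    (h𝔞 : SpecialLinearGroup.mapGL ℚ γ • (OnePoint.infty : OnePoint ℚ) = 𝔞) :
    ∃ σ : SL(2, ℝ), IsScalingMatrix Γ 𝔞 σ ∧ IsScaling γ (cuspWidth Γ 𝔞) σ :=
  have hm := cuspWidth_pos Γ 𝔞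
  ⟨toReal γ * scalingDiag _ hm, ⟨γ, h𝔞, hγ, Matrix.SpecialLinearGroup.coe_mul _ _⟩,
    hm, hγ, Matrix.SpecialLinearGroup.coe_mul _ _⟩

theorem autFactor_neg (γ : SL(2, ℤ)) (z : ℍ) :
    autFactor (toReal (-γ)) z = -autFactor (toReal γ) z := by
  simp only [autFactor, toReal_apply, Matrix.SpecialLinearGroup.coe_neg, Matrix.neg_apply]
  push_cast
  ring

/-! ### Multiplier, holomorphy and growth of the form at a cusp -/

/-- At a cusp, `f^σ` is periodic up to a unimodular factor. -/
theorem exists_multiplier_slash {Γ : Subgroup SL(2, ℤ)} {r : ℝ} {mu : SL(2, ℤ) → ℂ} {f : ℍ → ℂ}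
    (hf : IsModularForm Γ r mu f) {γ : SL(2, ℤ)} {m : ℕ} {σ : SL(2, ℝ)} (h : IsScaling γ m σ)
    (hmem : parabolic γ m ∈ Γ ∨ -parabolic γ m ∈ Γ) :
    ∃ ρ : ℂ, ‖ρ‖ = 1 ∧ ∀ z : ℍ, slash r σ f ((1 : ℝ) +ᵥ z) = ρ * slash r σ f z := by
  have hm : (0 : ℤ) < m := by exact_mod_cast h.pos
  have hnp : ∀ w : ℂ, w ≠ 0 → w ^ (r : ℂ) ≠ 0 := fun w hw => by
    rw [Complex.cpow_ne_zero_iff]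
    exact Or.inl hw
  have hA0 := fun z : ℍ => autFactor_ne_zero (toReal (parabolic γ m)) (σ • z)
  have hJ0 := fun z : ℍ => autFactor_ne_zero σ z
  rcases h.normalized with hc | ⟨hc, hd⟩
  · have hp : parabolic γ m 1 0 < 0 := by
      rw [parabolic_apply_one_zero]
      have : 0 < γ 1 0 ^ 2 := by nlinarith
      nlinarith [mul_pos this hm]
    set e := Complex.exp (Real.pi * Complex.I * r) with he
    have hen : ‖e‖ = 1 := by
      rw [he, Complex.norm_exp]
      simp
    have hcs : σ 1 0 < 0 := by
      rw [h.apply_zero]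
      exact mul_neg_of_neg_of_pos (by exact_mod_cast hc) h.sqrt_pos
    -- All three automorphy factors have negative imaginary part, so the power of the product A J
    -- cannot be split directly. Replacing A by -A moves it to the upper half-plane, where splitting
    -- is exact; the sign costs the same constant e on both sides. The form with -A serves the case
    -- in which only the negative of the parabolic element lies in Γ.
    have key : ∀ z : ℍ, (-autFactor (toReal (parabolic γ m)) (σ • z)) ^ (r : ℂ) *
        autFactor σ z ^ (r : ℂ) = e * autFactor σ ((1 : ℝ) +ᵥ z) ^ (r : ℂ) ∧
        (-autFactor (toReal (parabolic γ m)) (σ • z)) ^ (r : ℂ) =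
          e * autFactor (toReal (parabolic γ m)) (σ • z) ^ (r : ℂ) := fun z => by
      have hAim : (autFactor (toReal (parabolic γ m)) (σ • z)).im < 0 := by
        rw [im_autFactor, toReal_apply]
        exact mul_neg_of_neg_of_pos (by exact_mod_cast hp) (im_pos _)
      have hJim : (autFactor σ z).im < 0 := by
        rw [im_autFactor]
        exact mul_neg_of_neg_of_pos hcs z.im_pos
      have hJim' : (autFactor σ ((1 : ℝ) +ᵥ z)).im < 0 := by
        rw [im_autFactor]
        exact mul_neg_of_neg_of_pos hcs (im_pos _)
      constructor
      · rw [← mul_cpow_of_im_pos_of_im_neg (by simpa using hAim) hJim, neg_mul,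
          ← h.autFactor_vadd, neg_cpow_of_im_neg hJim']
      · exact neg_cpow_of_im_neg hAim _
    have he0 : e ≠ 0 := Complex.exp_ne_zero _
    rcases hmem with hmem | hmem
    · refine ⟨mu (parabolic γ m), hf.unimodular _ hmem, fun z => ?_⟩
      obtain ⟨k1, k2⟩ := key z
      rw [k2, mul_assoc] at k1
      have k3 := mul_left_cancel₀ he0 k1
      rw [slash, slash, h.smul_vadd, hf.law _ hmem, ← k3]
      have := hnp _ (hA0 z)
      have := hnp _ (hJ0 z)
      field_simp
    · refine ⟨mu (-parabolic γ m) * e, by rw [norm_mul, hen, hf.unimodular _ hmem, one_mul],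
        fun z => ?_⟩
      obtain ⟨k1, -⟩ := key z
      rw [slash, slash, h.smul_vadd, ← ModularGroup.SL_neg_smul, hf.law _ hmem, autFactor_neg]
      have := hnp _ (hJ0 z)
      have := hnp _ (hJ0 ((1 : ℝ) +ᵥ z))
      field_simp
      linear_combination (mu (-parabolic γ m)) * f (σ • z) * k1
  · have hA : ∀ z : ℍ, autFactor (toReal (parabolic γ m)) z = 1 := fun z => by
      rw [autFactor, toReal_apply, toReal_apply, parabolic_apply_one_zero,
        parabolic_apply_one_one, hc]
      simp
    have hJ : ∀ z : ℍ, autFactor σ ((1 : ℝ) +ᵥ z) = autFactor σ z := fun z => by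
      rw [h.autFactor_vadd, hA, one_mul]
    rcases hmem with hmem | hmem
    · refine ⟨mu (parabolic γ m), hf.unimodular _ hmem, fun z => ?_⟩
      rw [slash, slash, h.smul_vadd, hf.law _ hmem, hJ, hA, Complex.one_cpow]
      ring
    · refine ⟨mu (-parabolic γ m) * (-1) ^ (r : ℂ), ?_, fun z => ?_⟩
      · rw [norm_mul, hf.unimodular _ hmem, Complex.norm_cpow_real]
        simp
      · rw [slash, slash, h.smul_vadd, ← ModularGroup.SL_neg_smul, hf.law _ hmem, hJ,
          autFactor_neg, hA]
        ring

theorem exists_exp_two_pi_eq {ρ : ℂ} (hρ : ‖ρ‖ = 1) :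
    ∃ κ : ℝ, 0 ≤ κ ∧ κ < 1 ∧ Complex.exp (2 * Real.pi * Complex.I * κ) = ρ := by
  refine ⟨Int.fract (ρ.arg / (2 * Real.pi)), Int.fract_nonneg _, Int.fract_lt_one _, ?_⟩
  have h1 : Complex.exp (ρ.arg * Complex.I) = ρ := by
    have := Complex.norm_mul_exp_arg_mul_I ρ
    rwa [hρ, Complex.ofReal_one, one_mul] at this
  conv_rhs => rw [← h1]
  rw [Complex.exp_eq_exp_iff_exists_int]
  refine ⟨-⌊ρ.arg / (2 * Real.pi)⌋, ?_⟩
  rw [← Int.self_sub_floor]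
  have : (Real.pi : ℂ) ≠ 0 := by exact_mod_cast Real.pi_ne_zero
  push_cast
  field_simp
  ring

/-- A unimodular multiplier has a logarithm in [0, 1), so the choice in `cuspParam` is not vacuous.
For g = 0 the value is arbitrary in [0, 1), which does no harm: later arguments rest on these three
properties. -/
theorem cuspParam_spec {g : ℍ → ℂ} (h : ∃ ρ : ℂ, ‖ρ‖ = 1 ∧ ∀ z : ℍ, g ((1 : ℝ) +ᵥ z) = ρ * g z) :
    0 ≤ cuspParam g ∧ cuspParam g < 1 ∧ IsTwisted (cuspParam g) g := by
  obtain ⟨ρ, hρ, hz⟩ := h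
  obtain ⟨κ, h0, h1, rfl⟩ := exists_exp_two_pi_eq hρ
  exact Classical.epsilon_spec
    (p := fun κ : ℝ => 0 ≤ κ ∧ κ < 1 ∧
      ∀ z : ℍ, g ((1 : ℝ) +ᵥ z) = Complex.exp (2 * Real.pi * Complex.I * κ) * g z)
    ⟨κ, h0, h1, hz⟩

theorem hasDerivAt_smul (g : SL(2, ℝ)) {z : ℂ} (hz : 0 < z.im) :
    HasDerivAt (fun w : ℂ => ((g • ofComplex w : ℍ) : ℂ)) (1 / autFactor g (ofComplex z) ^ 2) z := by
  have h := (hasStrictDerivAt_smul (g := SpecialLinearGroup.mapGL ℝ g) (by simp)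
    (ofComplex z)).hasDerivAt
  rw [ofComplex_apply_of_im_pos hz] at h ⊢
  have hd : ((SpecialLinearGroup.mapGL ℝ g : GL (Fin 2) ℝ) : Matrix (Fin 2) (Fin 2) ℝ).det = 1 := by
    simp
  rw [hd, Complex.ofReal_one] at h
  exact h

theorem differentiableOn_slash {r : ℝ} {f : ℍ → ℂ}
    (hf : DifferentiableOn ℂ (f ∘ ofComplex) {z : ℂ | 0 < z.im}) {γ : SL(2, ℤ)} {m : ℕ}
    {σ : SL(2, ℝ)} (h : IsScaling γ m σ) :
    DifferentiableOn ℂ (slash r σ f ∘ ofComplex) {z : ℂ | 0 < z.im} := by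
  have hmap : DifferentiableOn ℂ (fun w : ℂ => ((σ • ofComplex w : ℍ) : ℂ)) {z : ℂ | 0 < z.im} :=
    fun z hz => (hasDerivAt_smul σ hz).differentiableAt.differentiableWithinAt
  have h1 : DifferentiableOn ℂ (fun w : ℂ => (f ∘ ofComplex) ((σ • ofComplex w : ℍ) : ℂ))
      {z : ℂ | 0 < z.im} :=
    hf.comp hmap fun z _ => (σ • ofComplex z : ℍ).im_pos
  have h2 : ∀ z ∈ {z : ℂ | 0 < z.im}, (σ 1 0 : ℂ) * z + σ 1 1 ∈ Complex.slitPlane := by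
    intro z hz
    have := h.autFactor_mem_slitPlane (ofComplex z)
    rwa [autFactor, ofComplex_apply_of_im_pos hz] at this
  have h3 : DifferentiableOn ℂ (fun w : ℂ => ((σ 1 0 : ℂ) * w + σ 1 1) ^ (r : ℂ))
      {z : ℂ | 0 < z.im} :=
    DifferentiableOn.cpow_const (Differentiable.differentiableOn (by fun_prop)) h2
  refine (h1.div h3 fun z hz => ?_).congr fun z hz => ?_
  · rw [Complex.cpow_ne_zero_iff]
    exact Or.inl (Complex.slitPlane_ne_zero (h2 z hz))
  · simp only [Function.comp_apply, slash, autFactor, ofComplex_apply, Pi.div_apply]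
    rw [ofComplex_apply_of_im_pos hz]

/-- Polynomial growth of `f` at a finite cusp. -/
theorem exists_growth_smul {Γ : Subgroup SL(2, ℤ)} {r : ℝ} (hr : 0 < r) {mu : SL(2, ℤ) → ℂ}
    {f : ℍ → ℂ} (hf : IsModularForm Γ r mu f) {g : SL(2, ℝ)} (hg : g 1 0 ≠ 0) :
    ∃ C K Y : ℝ, ∀ z : ℍ, |z.re| ≤ 1 → Y ≤ z.im →
      ‖f (g • z)‖ * (g • z).im ^ (r / 2) ≤ C * z.im ^ K := by
  obtain ⟨C, K, δ, hδ, hb⟩ := hf.growth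
  set c := g 1 0 with hc
  set d := g 1 1 with hd
  set δ' := min δ 1 with hδ'
  have hδ'0 : 0 < δ' := lt_min hδ one_pos
  have hc2 : 0 < c ^ 2 := by positivity
  set M := (2 * |c| + |d|) ^ 2 with hM
  -- In the strip, |j|^2 lies between c^2 y^2 and M y^2, so Im(gz) lies between 1/(M y) and 1/(c^2
  -- y). The height threshold pushes Im(gz) below δ', where the growth hypothesis applies.
  refine ⟨|C| * M ^ |K|, |K|, max 1 (2 / (c ^ 2 * δ')), fun z hx hy => ?_⟩
  have hy1 : 1 ≤ z.im := (le_max_left _ _).trans hy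
  have hy2 : 2 / (c ^ 2 * δ') ≤ z.im := (le_max_right _ _).trans hy
  have hy0 : 0 < z.im := z.im_pos
  have hJ0 : 0 < ‖autFactor g z‖ := norm_pos_iff.2 (autFactor_ne_zero g z)
  have hlow : c ^ 2 * z.im ^ 2 ≤ ‖autFactor g z‖ ^ 2 := by
    have h1 := Complex.abs_im_le_norm (autFactor g z)
    rw [im_autFactor] at h1
    rw [← mul_pow, ← sq_abs]
    gcongr
  have hup : ‖autFactor g z‖ ^ 2 ≤ M * z.im ^ 2 := by
    rw [hM, ← mul_pow]
    gcongr
    have hz : ‖(z : ℂ)‖ ≤ 1 + z.im := by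
      have := Complex.norm_le_abs_re_add_abs_im (z : ℂ)
      rw [coe_re, coe_im, abs_of_pos hy0] at this
      linarith
    calc ‖autFactor g z‖ ≤ ‖((c : ℝ) : ℂ) * z‖ + ‖((d : ℝ) : ℂ)‖ := norm_add_le _ _
      _ ≤ |c| * (1 + z.im) + |d| := by
        rw [norm_mul, Complex.norm_real, Complex.norm_real, Real.norm_eq_abs, Real.norm_eq_abs]
        gcongr
      _ ≤ (2 * |c| + |d|) * z.im := by
        nlinarith [mul_nonneg (abs_nonneg c) (sub_nonneg.2 hy1),
          mul_nonneg (abs_nonneg d) (sub_nonneg.2 hy1)]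
  set y := (g • z).im with hydef
  have hyeq : y = z.im / ‖autFactor g z‖ ^ 2 := im_smul_real g z
  have hypos : 0 < y := im_pos _
  have hylt : y < δ' := by
    rw [hyeq, div_lt_iff₀ (by positivity)]
    rw [div_le_iff₀ (by positivity)] at hy2
    have h1 : δ' * (c ^ 2 * z.im ^ 2) ≤ δ' * ‖autFactor g z‖ ^ 2 := by gcongr
    nlinarith
  have hyle : y ≤ 1 := hylt.le.trans (min_le_right _ _)
  have h1 := hb (g • z) (hylt.trans_le (min_le_left _ _))
  have h2 : y ^ (-K) ≤ (M * z.im) ^ |K| := by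
    calc y ^ (-K) ≤ y ^ (-|K|) :=
          Real.rpow_le_rpow_of_exponent_ge hypos hyle (neg_le_neg (le_abs_self K))
      _ = (y⁻¹) ^ |K| := by rw [Real.rpow_neg hypos.le, Real.inv_rpow hypos.le]
      _ ≤ _ := by
        gcongr
        rw [hyeq, inv_div, div_le_iff₀ hy0]
        linarith
  have h3 : y ^ (r / 2) ≤ 1 := Real.rpow_le_one hypos.le hyle (by positivity)
  calc ‖f (g • z)‖ * y ^ (r / 2) ≤ (C * y ^ (-K)) * 1 := by
        have := (norm_nonneg _).trans h1
        gcongr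
    _ ≤ |C| * (M * z.im) ^ |K| := by
        rw [mul_one]
        have : 0 ≤ y ^ (-K) := by positivity
        gcongr
        exact le_abs_self C
    _ = _ := by
        rw [Real.mul_rpow (by positivity) hy0.le, mul_assoc]

/-- The growth hypothesis speaks only of Im z → 0 and says nothing directly about the cusp ∞. An
element of Γ moves ∞ to a finite cusp without changing |f| (Im z)^(r/2); a power of the lower
triangular S T S⁻¹ does so. -/
theorem exists_mem_mul_apply_one_zero_ne (Γ : Subgroup SL(2, ℤ)) [Γ.FiniteIndex] (γ : SL(2, ℤ)) :
    ∃ δ ∈ Γ, (δ * γ) 1 0 ≠ 0 := by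
  by_cases hc : γ 1 0 = 0
  · obtain ⟨n, hn, -, hmem⟩ := Subgroup.exists_pow_mem_of_index_ne_zero
      (Subgroup.FiniteIndex.index_ne_zero (H := Γ))
      (ModularGroup.S * ModularGroup.T * ModularGroup.S⁻¹)
    refine ⟨_, hmem, ?_⟩
    have hd := γ.det_coe
    rw [Matrix.det_fin_two, hc, mul_zero, sub_zero] at hd
    rw [conj_pow]
    have h0 : γ 0 0 ≠ 0 := left_ne_zero_of_mul_eq_one hd
    rw [Matrix.SpecialLinearGroup.coe_mul, Matrix.mul_apply, Fin.sum_univ_two, hc, mul_zero,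
      add_zero]
    refine mul_ne_zero ?_ h0
    have := parabolic_apply_one_zero ModularGroup.S n
    rw [parabolic] at this
    rw [this]
    simpa [ModularGroup.S] using hn.ne'
  · exact ⟨1, Γ.one_mem, by rwa [one_mul]⟩

theorem IsTwisted.norm_eq {κ : ℝ} {g : ℍ → ℂ} (h : IsTwisted κ g) (z : ℍ) :
    ∃ w : ℍ, |w.re| ≤ 1 ∧ w.im = z.im ∧ ‖g w‖ = ‖g z‖ := by
  have hper : Function.Periodic (fun x : ℝ => ‖g (ofComplex (x + z.im * Complex.I))‖) 1 := by
    intro x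
    have him : 0 < ((x : ℂ) + z.im * Complex.I).im := by simpa using z.im_pos
    have h1 : (((x + 1 : ℝ) : ℂ) + z.im * Complex.I) = (x + z.im * Complex.I) + 1 := by
      push_cast
      ring
    simp only
    rw [h1, ofComplex_add_one him, h, norm_mul]
    have := norm_exp_mul_coe κ 1
    simp only [mul_one, Complex.one_im, mul_zero, neg_zero, Real.exp_zero] at this
    rw [this, one_mul]
  have h2 := hper.sub_int_mul_eq (x := z.re) ⌊z.re⌋
  have h3 : (z.re : ℂ) + z.im * Complex.I = z := by apply Complex.ext <;> simp
  simp only [mul_one] at h2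
  rw [h3, ofComplex_apply, Int.self_sub_floor] at h2
  refine ⟨ofComplex ((Int.fract z.re : ℝ) + z.im * Complex.I), ?_, im_ofComplex_add z.im_pos, h2⟩
  rw [← coe_re, coe_ofComplex_add z.im_pos]
  simp [abs_of_nonneg (Int.fract_nonneg z.re), (Int.fract_lt_one z.re).le]

theorem fourierCoef_eq_twistedCoef {g : ℍ → ℂ} (hg : IsTwisted (cuspParam g) g)
    (hol : DifferentiableOn ℂ (g ∘ ofComplex) {z : ℂ | 0 < z.im})
    (hb : IsBoundedAtImInfty (untwist (cuspParam g) g)) (n : ℕ) :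
    fourierCoef g n = twistedCoef (cuspParam g) g n := by
  rw [twistedCoef_eq_integral hg hol hb n one_pos, fourierCoef]
  simp

theorem parabolic_mem_or_of_eq {Γ : Subgroup SL(2, ℤ)} {𝔞 : OnePoint ℚ} {γ : SL(2, ℤ)}
    (h : SpecialLinearGroup.mapGL ℚ γ • (OnePoint.infty : OnePoint ℚ) = 𝔞) :
    parabolic γ (cuspWidth Γ 𝔞) ∈ Γ ∨ -parabolic γ (cuspWidth Γ 𝔞) ∈ Γ := by
  subst h
  exact parabolic_mem_or Γ γ

/-! ### Hecke's bound and the resulting twisted forms -/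

/-- At each cusp, the invariant function `‖f z‖ (im z) ^ (r / 2)` is bounded. -/
theorem isBigO_one_of_isScaling {Γ : Subgroup SL(2, ℤ)} [Γ.FiniteIndex] {r : ℝ} (hr : 0 < r)
    {mu : SL(2, ℤ) → ℂ} {f : ℍ → ℂ} (hf : IsCuspForm Γ r mu f) {𝔞 : OnePoint ℚ} {γ : SL(2, ℤ)}
    {σ : SL(2, ℝ)} (h𝔞 : SpecialLinearGroup.mapGL ℚ γ • (OnePoint.infty : OnePoint ℚ) = 𝔞)
    (hσ : IsScalingMatrix Γ 𝔞 σ) (h : IsScaling γ (cuspWidth Γ 𝔞) σ) :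
    (fun z : ℍ => ‖f (σ • z)‖ * (σ • z).im ^ (r / 2)) =O[atImInfty] fun _ => (1 : ℝ) := by
  set g := slash r σ f with hg
  have hmod := hf.toIsModularForm
  obtain ⟨k0, k1, htw⟩ := cuspParam_spec
    (exists_multiplier_slash hmod h (parabolic_mem_or_of_eq h𝔞))
  have hol : DifferentiableOn ℂ (g ∘ ofComplex) {z : ℂ | 0 < z.im} := differentiableOn_slash hmod.holo h
  obtain ⟨δ₀, hδ₀, hne⟩ := exists_mem_mul_apply_one_zero_ne Γ γ
  have hne' : (toReal δ₀ * σ) 1 0 ≠ 0 := by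
    have e : (toReal δ₀ * σ) 1 0 = ((δ₀ * γ) 1 0 : ℝ) * √(cuspWidth Γ 𝔞 : ℝ) := by
      simp only [Matrix.SpecialLinearGroup.coe_mul, Matrix.mul_apply, Fin.sum_univ_two,
        h.apply_zero, toReal_apply]
      push_cast
      ring
    rw [e]
    exact mul_ne_zero (by exact_mod_cast hne) h.sqrt_pos.ne'
  obtain ⟨C, K, Y, hY⟩ := exists_growth_smul hr hmod hne'
  -- Periodicity of |g| reduces to |Re z| ≤ 1. There the growth at the finite cusp of δ₀γ transfers
  -- back, since δ₀ ∈ Γ preserves the invariant function.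
  have hgrow : g =O[atImInfty] fun z => z.im ^ K := by
    refine IsBigO.of_bound C ((atImInfty_mem _).2 ⟨max 1 Y, fun z hz => ?_⟩)
    obtain ⟨w, hw1, hw2, hw3⟩ := htw.norm_eq z
    have hy1 : 1 ≤ w.im := by rw [hw2]; exact (le_max_left _ _).trans hz
    have hb := hY w hw1 (by rw [hw2]; exact (le_max_right _ _).trans hz)
    rw [mul_smul, toReal_smul, norm_mul_im_rpow_invariant hmod hδ₀, ← norm_slash, ← hg] at hb
    have h1 : 1 ≤ w.im ^ (r / 2) := Real.one_le_rpow hy1 (by positivity)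
    change ‖g z‖ ≤ C * ‖z.im ^ K‖
    rw [Real.norm_of_nonneg (Real.rpow_nonneg z.im_pos.le _), ← hw3, ← hw2]
    exact (le_mul_of_one_le_right (norm_nonneg _) h1).trans hb
  have hbd := isBoundedAtImInfty_untwist k1 htw hol hgrow
  have hcusp := hf.cuspidal 𝔞 σ hσ
  rw [← hg, fourierCoef_eq_twistedCoef htw hol hbd] at hcusp
  obtain ⟨δ, hδ, hexp⟩ := exists_isBigO_exp htw hol hbd k0 hcusp
  have hlim : Tendsto (fun z : ℍ => Real.exp (-δ * z.im) * z.im ^ (r / 2)) atImInfty (𝓝 0) := by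
    have h1 := tendsto_rpow_mul_exp_neg_mul_atTop_nhds_zero (r / 2) δ hδ
    have h2 : Tendsto UpperHalfPlane.im atImInfty atTop := tendsto_comap
    refine (h1.comp h2).congr fun z => ?_
    simp [mul_comm]
  have hO : (fun z : ℍ => ‖g z‖ * z.im ^ (r / 2)) =O[atImInfty]
      fun z => Real.exp (-δ * z.im) * z.im ^ (r / 2) := hexp.norm_left.mul (isBigO_refl _ _)
  refine (hO.trans (hlim.isBigO_one ℝ)).congr_left fun z => ?_
  exact norm_slash r σ f z

theorem exists_sign_normalized (γ : SL(2, ℤ)) : ∃ γ' : SL(2, ℤ), (γ' = γ ∨ γ' = -γ) ∧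
    (γ' 1 0 < 0 ∨ (γ' 1 0 = 0 ∧ γ' 1 1 = 1)) := by
  rcases lt_trichotomy (γ 1 0) 0 with hc | hc | hc
  · exact ⟨γ, Or.inl rfl, Or.inl hc⟩
  · have hd := γ.det_coe
    rw [Matrix.det_fin_two, hc, mul_zero, sub_zero] at hd
    rcases Int.eq_one_or_neg_one_of_mul_eq_one' hd with ⟨-, h2⟩ | ⟨-, h2⟩
    · exact ⟨γ, Or.inl rfl, Or.inr ⟨hc, h2⟩⟩
    · exact ⟨-γ, Or.inr rfl, Or.inr ⟨by simp [hc], by simp [h2]⟩⟩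
  · exact ⟨-γ, Or.inr rfl, Or.inl (by simpa using hc)⟩

/-- For a cusp form, the invariant function `‖f z‖ (im z) ^ (r / 2)` is bounded. -/
theorem IsCuspForm.exists_bound {Γ : Subgroup SL(2, ℤ)} [Γ.FiniteIndex] {r : ℝ} (hr : 0 < r)
    {mu : SL(2, ℤ) → ℂ} {f : ℍ → ℂ} (hf : IsCuspForm Γ r mu f) :
    ∃ C : ℝ, ∀ z : ℍ, ‖f z‖ * z.im ^ (r / 2) ≤ C := by
  have hmod := hf.toIsModularForm
  have hcont : Continuous f := (mdifferentiable_iff.2 hmod.holo).continuous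
  have hcont' : Continuous fun z : ℍ => ‖f z‖ * z.im ^ (r / 2) :=
    hcont.norm.mul (continuous_im.rpow_const fun z => Or.inl z.im_ne_zero)
  -- A fundamental domain of Γ consists of finitely many translates of the standard one, so
  -- boundedness along every γ suffices. Each γ equals a scaling matrix up to sign and the dilation
  -- z ↦ z/m; the exponent 0 expresses plain boundedness.
  have hinf : ∀ γ : SL(2, ℤ), (fun z : ℍ => ‖f (γ • z)‖ * (γ • z).im ^ (r / 2)) =O[atImInfty]
      fun z => z.im ^ (0 : ℝ) := by
    intro γ
    obtain ⟨γ', hγ', hn⟩ := exists_sign_normalized γ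
    obtain ⟨σ, hσ, hs⟩ := exists_isScalingMatrix Γ hn rfl
    have hO := isBigO_one_of_isScaling hr hf rfl hσ hs
    set m := cuspWidth Γ (SpecialLinearGroup.mapGL ℚ γ' • (OnePoint.infty : OnePoint ℚ)) with hm
    have hm0 : (0 : ℝ) < m := by exact_mod_cast hs.pos
    have hτ : ∀ z : ℍ, 0 < ((z : ℂ) / m).im := fun z => by
      rw [Complex.div_natCast_im, coe_im]
      have := z.im_pos
      positivity
    have hlim : Tendsto (fun z : ℍ => ofComplex ((z : ℂ) / m)) atImInfty atImInfty := by
      rw [atImInfty, tendsto_comap_iff]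
      have h2 : Tendsto UpperHalfPlane.im atImInfty atTop := tendsto_comap
      refine (h2.atTop_div_const hm0).congr fun z => ?_
      simp only [Function.comp_apply]
      rw [ofComplex_apply_of_im_pos (hτ z)]
      change z.im / m = ((z : ℂ) / m).im
      rw [Complex.div_natCast_im, coe_im]
    have h1 := hO.comp_tendsto hlim
    simp only [Function.comp_def] at h1
    simp only [Real.rpow_zero]
    refine h1.congr_left fun z => ?_
    have e : σ • ofComplex ((z : ℂ) / m) = γ • z := by
      rw [hs.smul_eq (w := z)]
      · rcases hγ' with h | h
        · rw [h]
        · rw [h, ModularGroup.SL_neg_smul]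
      · rw [ofComplex_apply_of_im_pos (hτ z)]
        change (z : ℂ) = m * ((z : ℂ) / m)
        have : (m : ℂ) ≠ 0 := by exact_mod_cast hs.pos.ne'
        field_simp
    rw [e]
  obtain ⟨C, hC⟩ := ModularGroup.exists_bound_of_subgroup_invariant_of_isBigO hcont'
    le_rfl hinf (Γ := Γ) fun γ hγ z => norm_mul_im_rpow_invariant hmod hγ z
  refine ⟨C, fun z => ?_⟩
  have := (le_abs_self _).trans (hC z)
  simpa using this

theorem IsCuspForm.isTwistedForm_slash {Γ : Subgroup SL(2, ℤ)} [Γ.FiniteIndex] {r : ℝ} (hr : 0 < r)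
    {mu : SL(2, ℤ) → ℂ} {f : ℍ → ℂ} (hf : IsCuspForm Γ r mu f) {C : ℝ}
    (hC : ∀ z : ℍ, ‖f z‖ * z.im ^ (r / 2) ≤ C) {𝔞 : OnePoint ℚ} {γ : SL(2, ℤ)} {σ : SL(2, ℝ)}
    (h𝔞 : SpecialLinearGroup.mapGL ℚ γ • (OnePoint.infty : OnePoint ℚ) = 𝔞)
    (h : IsScaling γ (cuspWidth Γ 𝔞) σ) :
    IsTwistedForm (cuspParam (slash r σ f)) (r / 2) C (slash r σ f) := by
  obtain ⟨k0, k1, htw⟩ := cuspParam_spec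
    (exists_multiplier_slash hf.toIsModularForm h (parabolic_mem_or_of_eq h𝔞))
  refine ⟨htw, differentiableOn_slash hf.holo h, k0, k1, by positivity, fun z => ?_⟩
  have h1 := hC (σ • z)
  rwa [← norm_slash, ← le_div_iff₀ (Real.rpow_pos_of_pos z.im_pos _), div_eq_mul_inv,
    ← Real.rpow_neg z.im_pos.le] at h1

/-- The Fourier expansion at infinity, written with the dilation by the width. -/
theorem IsCuspForm.isTwistedForm_dilate {Γ : Subgroup SL(2, ℤ)} [Γ.FiniteIndex] {r : ℝ} (hr : 0 < r)
    {mu : SL(2, ℤ) → ℂ} {f : ℍ → ℂ} (hf : IsCuspForm Γ r mu f) {C : ℝ}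
    (hC : ∀ z : ℍ, ‖f z‖ * z.im ^ (r / 2) ≤ C) :
    ∃ C' : ℝ, IsTwistedForm (cuspParam (dilate (cuspWidth Γ OnePoint.infty) f)) (r / 2) C'
      (dilate (cuspWidth Γ OnePoint.infty) f) := by
  set m := cuspWidth Γ OnePoint.infty with hm
  have hone : SpecialLinearGroup.mapGL ℚ (1 : SL(2, ℤ)) • (OnePoint.infty : OnePoint ℚ)
      = OnePoint.infty := by simp
  obtain ⟨σ, -, hs⟩ := exists_isScalingMatrix Γ (γ := 1) (by right; simp) hone
  have hslash := hf.isTwistedForm_slash hr hC hone hs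
  rw [← hm] at hs
  have hm0 : (0 : ℝ) < m := by exact_mod_cast hs.pos
  have hj : ∀ z : ℍ, autFactor σ z = ((1 / √(m : ℝ) : ℝ) : ℂ) := fun z => by
    rw [autFactor, hs.apply_zero, hs.apply_one]
    simp
  set b : ℂ := ((1 / √(m : ℝ) : ℝ) : ℂ) ^ (r : ℂ) with hb
  have hb0 : b ≠ 0 := by
    rw [hb, Complex.cpow_ne_zero_iff]
    left
    rw [← hj UpperHalfPlane.I]
    exact autFactor_ne_zero _ _
  have hdil : dilate m f = fun z => b * slash r σ f z := by
    ext z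
    have him : 0 < ((m : ℂ) * z).im := by
      rw [← nsmul_eq_mul, Complex.smul_im, nsmul_eq_mul, coe_im]
      have := z.im_pos
      positivity
    rw [dilate, slash, hj, hs.smul_eq z (w := ofComplex ((m : ℂ) * z)), one_smul,
      mul_div_cancel₀ _ hb0]
    rw [ofComplex_apply_of_im_pos him]
  -- The parameter κ of the dilation is a choice of its own, so its properties come from the
  -- multiplier instead of being copied from the proportional function f^σ.
  have hmult : ∃ ρ : ℂ, ‖ρ‖ = 1 ∧ ∀ z : ℍ, dilate m f ((1 : ℝ) +ᵥ z) = ρ * dilate m f z := by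
    obtain ⟨ρ, h1, h2⟩ := exists_multiplier_slash hf.toIsModularForm hs
      (parabolic_mem_or_of_eq hone)
    refine ⟨ρ, h1, fun z => ?_⟩
    rw [hdil]
    simp only [h2]
    ring
  obtain ⟨k0, k1, htw⟩ := cuspParam_spec hmult
  refine ⟨‖b‖ * C, htw, ?_, k0, k1, by positivity, fun z => ?_⟩
  · rw [hdil]
    exact hslash.holo.const_mul b
  · rw [hdil, norm_mul, mul_assoc]
    gcongr
    exact hslash.bound z

/-! ### Primitives and their limits along rays -/

/-- A holomorphic function on the upper half-plane has a primitive. -/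
theorem exists_primitive_upperHalfPlane {Φ : ℂ → ℂ}
    (hΦ : DifferentiableOn ℂ Φ {z : ℂ | 0 < z.im}) :
    ∃ P : ℂ → ℂ, ∀ z : ℂ, 0 < z.im → HasDerivAt P (Φ z) z := by
  have hone : ∀ w ∈ Metric.ball (0 : ℂ) 1, 1 - w ≠ 0 := fun w hw h => by
    rw [sub_eq_zero] at h
    rw [← h] at hw
    simp at hw
  have him : ∀ w ∈ Metric.ball (0 : ℂ) 1, 0 < (Complex.I * (1 + w) / (1 - w)).im := fun w hw => by
    have h1 := Complex.normSq_pos.2 (hone w hw)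
    have h2 : Complex.normSq w < 1 := by
      rw [Complex.normSq_eq_norm_sq]
      have : ‖w‖ < 1 := by simpa using hw
      nlinarith [norm_nonneg w]
    rw [Complex.normSq_apply] at h2
    have h3 : (Complex.I * (1 + w) / (1 - w)).im
        = (1 - (w.re * w.re + w.im * w.im)) / Complex.normSq (1 - w) := by
      rw [Complex.div_im]
      simp
      field_simp
      ring
    rw [h3]
    exact div_pos (by linarith) h1
  -- The Cayley transform w ↦ i(1 + w)/(1 - w), with derivative 2i/(1 - w)^2, moves the problem to
  -- the unit disc, where holomorphic functions have primitives.
  have hdisc : DifferentiableOn ℂ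
      (fun w => Φ (Complex.I * (1 + w) / (1 - w)) * (2 * Complex.I / (1 - w) ^ 2))
      (Metric.ball 0 1) := by
    refine DifferentiableOn.mul (hΦ.comp ?_ him) ?_
    · exact DifferentiableOn.div (Differentiable.differentiableOn (by fun_prop))
        (Differentiable.differentiableOn (by fun_prop)) hone
    · exact DifferentiableOn.div (Differentiable.differentiableOn (by fun_prop))
        (Differentiable.differentiableOn (by fun_prop)) fun w hw => pow_ne_zero 2 (hone w hw)
  obtain ⟨Q, hQ⟩ := hdisc.isConservativeOn.isExactOn_ball hdisc.continuousOn
  refine ⟨fun z => Q ((z - Complex.I) / (z + Complex.I)), fun z hz => ?_⟩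
  have hzI : z + Complex.I ≠ 0 := fun h => by
    have := congr_arg Complex.im h
    simp at this
    linarith
  have hI : (2 * Complex.I) ≠ 0 := by simp
  have hw1 : 1 - (z - Complex.I) / (z + Complex.I) = 2 * Complex.I / (z + Complex.I) := by
    field_simp
    ring
  have hball : (z - Complex.I) / (z + Complex.I) ∈ Metric.ball (0 : ℂ) 1 := by
    rw [mem_ball_zero_iff, norm_div, div_lt_one (norm_pos_iff.2 hzI)]
    rw [← sq_lt_sq₀ (norm_nonneg _) (norm_nonneg _), ← Complex.normSq_eq_norm_sq,
      ← Complex.normSq_eq_norm_sq, Complex.normSq_apply, Complex.normSq_apply]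
    simp
    nlinarith
  have hinner : HasDerivAt (fun z : ℂ => (z - Complex.I) / (z + Complex.I))
      (2 * Complex.I / (z + Complex.I) ^ 2) z := by
    have := ((hasDerivAt_id z).sub_const Complex.I).div ((hasDerivAt_id z).add_const Complex.I) hzI
    refine this.congr_deriv ?_
    simp only [id_eq]
    congr 1
    ring
  have h := (hQ _ hball).comp z hinner
  refine h.congr_deriv ?_
  simp only
  rw [hw1]
  have : Complex.I * (1 + (z - Complex.I) / (z + Complex.I)) / (2 * Complex.I / (z + Complex.I))
      = z := by
    field_simp
    ring
  rw [this]
  field_simp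

/-- Both truncation points are free sequences, so that the cut-offs of different rays can later be
matched under σ. -/
theorem tendsto_sub_integral_Ioi {u u' : ℝ → ℂ} (hd : ∀ t, 0 < t → HasDerivAt u (u' t) t)
    (hint : IntegrableOn u' (Set.Ioi 0)) {a b : ℕ → ℝ} (ha0 : ∀ᶠ n in atTop, 0 < a n)
    (ha : Tendsto a atTop (𝓝 0)) (hb : Tendsto b atTop atTop) :
    Tendsto (fun n => u (b n) - u (a n)) atTop (𝓝 (∫ t in Set.Ioi (0 : ℝ), u' t)) := by
  have hcov : AECover (volume.restrict (Set.Ioi (0 : ℝ))) atTop fun n => Set.Ioc (a n) (b n) := by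
    have h1 : AECover (volume.restrict (Set.Ioi (0 : ℝ))) atTop fun n => Set.Ioi (a n) :=
      aecover_Ioi_of_Ioi ha
    have h2 : AECover (volume.restrict (Set.Ioi (0 : ℝ))) atTop fun n => Set.Iic (b n) :=
      (aecover_Iic hb).restrict
    exact h1.inter h2
  refine (hcov.integral_tendsto_of_countably_generated hint).congr' ?_
  filter_upwards [ha0, ha.eventually_lt_const one_pos, hb.eventually_ge_atTop 1] with n h1 h2 h3
  have hab : a n ≤ b n := by linarith
  have hsub : Set.Ioc (a n) (b n) ⊆ Set.Ioi 0 := fun t ht => h1.trans ht.1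
  rw [Measure.restrict_restrict measurableSet_Ioc, Set.inter_eq_left.2 hsub,
    ← intervalIntegral.integral_of_le hab]
  refine intervalIntegral.integral_eq_sub_of_hasDerivAt (fun t ht => hd t ?_) ?_
  · rw [Set.uIcc_of_le hab] at ht
    exact h1.trans_le ht.1
  · rw [intervalIntegrable_iff_integrableOn_Ioc_of_le hab]
    exact hint.mono_set hsub

/-- Mean value estimate on a horizontal segment. -/
theorem norm_sub_le_of_horizontal {P Φ : ℂ → ℂ} (hP : ∀ z : ℂ, 0 < z.im → HasDerivAt P (Φ z) z)
    {p q T B : ℝ} (hT : 0 < T)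
    (hB : ∀ ξ ∈ Set.uIcc p q, ‖Φ (ξ + T * Complex.I)‖ ≤ B) :
    ‖P (q + T * Complex.I) - P (p + T * Complex.I)‖ ≤ B * |q - p| := by
  have hd : ∀ ξ ∈ Set.uIcc p q, HasDerivWithinAt (fun ξ : ℝ => P (ξ + T * Complex.I))
      (Φ (ξ + T * Complex.I)) (Set.uIcc p q) ξ := fun ξ _ => by
    have h1 : HasDerivAt (fun ξ : ℝ => (ξ : ℂ) + T * Complex.I) 1 ξ :=
      (Complex.ofRealCLM.hasDerivAt (x := ξ)).add_const (T * Complex.I)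
    have h2 := (hP (ξ + T * Complex.I) (by simpa using hT)).comp ξ h1
    rw [mul_one] at h2
    exact h2.hasDerivWithinAt
  have := Convex.norm_image_sub_le_of_norm_hasDerivWithin_le hd hB (convex_uIcc p q)
    Set.left_mem_uIcc Set.right_mem_uIcc
  rwa [Real.norm_eq_abs] at this

theorem norm_add_mul_I_cpow_le {ξ x T s A : ℝ} (hs : 0 ≤ s) (hT : 0 < T) (hA : |ξ - x| ≤ A) :
    ‖((ξ + T * Complex.I) - x : ℂ) ^ (s : ℂ)‖ ≤ (A + T) ^ s := by
  rw [Complex.norm_cpow_real]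
  gcongr
  calc ‖((ξ + T * Complex.I) - x : ℂ)‖ = ‖((ξ - x : ℝ) : ℂ) + T * Complex.I‖ := by
        congr 1; push_cast; ring
    _ ≤ ‖((ξ - x : ℝ) : ℂ)‖ + ‖T * Complex.I‖ := norm_add_le _ _
    _ ≤ A + T := by
        rw [Complex.norm_real, norm_mul, Complex.norm_I, mul_one, Complex.norm_real,
          Real.norm_eq_abs, Real.norm_of_nonneg hT.le]
        gcongr

/-- The primitive of an exponentially decaying function times a power has the same limit along all
vertical rays. -/
theorem tendsto_horizontal_sub {P : ℂ → ℂ} {g : ℍ → ℂ} {k : ℂ} {s x : ℝ} (hs : 0 ≤ s)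
    (hP : ∀ z : ℂ, 0 < z.im → HasDerivAt P (k * ((z - x) ^ (s : ℂ) * g (ofComplex z))) z)
    {D δ Y : ℝ} (hδ : 0 < δ) (hg : ∀ z : ℍ, Y ≤ z.im → ‖g z‖ ≤ D * Real.exp (-δ * z.im))
    (p q : ℝ) :
    Tendsto (fun n : ℕ => P (q + (n : ℝ) * Complex.I) - P (p + (n : ℝ) * Complex.I)) atTop
      (𝓝 0) := by
  set A := |p - x| + |q - x| with hA
  have h1 : Tendsto (fun n : ℕ => ‖k‖ * (2 ^ s * D * ((n : ℝ) ^ s * Real.exp (-δ * n))) * |q - p|)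
      atTop (𝓝 0) := by
    have h := (tendsto_rpow_mul_exp_neg_mul_atTop_nhds_zero s δ hδ).comp tendsto_natCast_atTop_atTop
    simpa using ((h.const_mul (2 ^ s * D)).const_mul ‖k‖).mul_const |q - p|
  refine squeeze_zero_norm' ?_ h1
  filter_upwards [tendsto_natCast_atTop_atTop.eventually_ge_atTop (max (max 1 Y) A)] with n hn
  have hn1 : (1 : ℝ) ≤ n := (le_max_left _ _).trans ((le_max_left _ _).trans hn)
  have hnY : Y ≤ n := (le_max_right _ _).trans ((le_max_left _ _).trans hn)
  have hnA : A ≤ n := (le_max_right _ _).trans hn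
  have hn0 : (0 : ℝ) < n := by linarith
  refine norm_sub_le_of_horizontal hP hn0 fun ξ hξ => ?_
  have hξA : |ξ - x| ≤ A := by
    have e1 := abs_nonneg (p - x)
    have e2 := abs_nonneg (q - x)
    have e3 := abs_le.1 (le_refl |p - x|)
    have e4 := abs_le.1 (le_refl |q - x|)
    rw [abs_le]
    rcases Set.mem_uIcc.1 hξ with h | h <;> constructor <;> linarith [h.1, h.2]
  have hgn := hg (ofComplex (ξ + (n : ℝ) * Complex.I)) (by rwa [im_ofComplex_add hn0])
  rw [im_ofComplex_add hn0] at hgn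
  rw [norm_mul, norm_mul]
  refine mul_le_mul_of_nonneg_left ?_ (norm_nonneg k)
  calc _ ≤ (A + n) ^ s * (D * Real.exp (-δ * n)) := by
        gcongr
        exact norm_add_mul_I_cpow_le hs hn0 hξA
    _ ≤ (2 * n) ^ s * (D * Real.exp (-δ * n)) := by
        have := (norm_nonneg _).trans hgn
        have hA0 : 0 ≤ A := by positivity
        gcongr
        linarith
    _ = _ := by
        rw [Real.mul_rpow (by norm_num) hn0.le]
        ring

/-! ### Transformation of the Eichler kernel under a scaling matrix -/

theorem det_eq_one (σ : SL(2, ℝ)) : σ 0 0 * σ 1 1 - σ 0 1 * σ 1 0 = 1 := by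
  have := σ.det_coe
  rwa [Matrix.det_fin_two] at this

theorem moebius_inv (σ : SL(2, ℝ)) (x : ℝ) :
    moebius σ⁻¹ x = (σ 1 1 * x - σ 0 1) / (-σ 1 0 * x + σ 0 0) := by
  simp only [moebius, Matrix.SpecialLinearGroup.coe_inv, Matrix.adjugate_fin_two]
  simp [sub_eq_add_neg]

theorem autFactor_mul_smul_sub (σ : SL(2, ℝ)) {x : ℝ} (hq : -σ 1 0 * x + σ 0 0 ≠ 0) (w : ℍ) :
    (((σ • w : ℍ) : ℂ) - x) * autFactor σ w =
      ((-σ 1 0 * x + σ 0 0 : ℝ) : ℂ) * (w - (moebius σ⁻¹ x : ℝ)) := by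
  have hj := autFactor_ne_zero σ w
  have hy : (-σ 1 0 * x + σ 0 0) * moebius σ⁻¹ x = σ 1 1 * x - σ 0 1 := by
    rw [moebius_inv, mul_div_cancel₀ _ hq]
  have hy' : ((-σ 1 0 * x + σ 0 0 : ℝ) : ℂ) * (moebius σ⁻¹ x : ℝ) = σ 1 1 * x - σ 0 1 := by
    exact_mod_cast congr_arg (fun t : ℝ => (t : ℂ)) hy
  rw [mul_sub, hy', coe_smul_real, sub_mul, div_mul_cancel₀ _ hj, autFactor]
  push_cast
  ring

theorem ofReal_mul_cpow {a : ℝ} (ha : 0 < a) {w : ℂ} (hw : w ≠ 0) (s : ℂ) :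
    ((a : ℂ) * w) ^ s = (a : ℂ) ^ s * w ^ s := by
  refine mul_cpow_of_arg_add_mem (by exact_mod_cast ha.ne') hw ?_ s
  rw [Complex.arg_ofReal_of_nonneg ha.le, zero_add]
  exact Complex.arg_mem_Ioc w

/-- The constant relating the kernels `(z - x) ^ (r - 2)` and `(w - y) ^ (r - 2)`, `z = σ w`. -/
def kernelFactor (r c u : ℝ) : ℂ :=
  ((|c| ^ (r - 2) : ℝ) : ℂ) * (((|u| ^ (2 * (r - 1)) : ℝ) : ℂ) * (u : ℂ) ^ (-r : ℂ))

/-- By `autFactor_mul_smul_sub`, (σw - x) j_σ(w) = |c| (x - x₀) (w - y), and the power of the left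
side splits since the factors lie in opposite half-planes. For x < x₀ the negative real factor
produces exp(-πi(r - 2)) = exp(-πir). The principal value of (x - x₀)^(-r) carries the same phase,
so one formula covers both signs. -/
theorem kernel_transform {r : ℝ} {σ : SL(2, ℝ)} (hc : σ 1 0 < 0) {x x₀ : ℝ}
    (hx₀ : x₀ * σ 1 0 = σ 0 0) (hx : x ≠ x₀) (w : ℍ) :
    (((σ • w : ℍ) : ℂ) - x) ^ ((r - 2 : ℝ) : ℂ) * autFactor σ w ^ ((r - 2 : ℝ) : ℂ) =
      kernelFactor r (σ 1 0) (x - x₀) * ((w : ℂ) - (moebius σ⁻¹ x : ℝ)) ^ ((r - 2 : ℝ) : ℂ) := by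
  have hqe : -σ 1 0 * x + σ 0 0 = -σ 1 0 * (x - x₀) := by linear_combination -hx₀
  have hc' : 0 < -σ 1 0 := by linarith
  have hca : |σ 1 0| = -σ 1 0 := abs_of_neg hc
  have hq : -σ 1 0 * x + σ 0 0 ≠ 0 := by
    rw [hqe]
    exact mul_ne_zero hc'.ne' (sub_ne_zero.2 hx)
  set W : ℂ := (w : ℂ) - (moebius σ⁻¹ x : ℝ) with hW
  have hWim : 0 < W.im := by
    rw [hW, Complex.sub_im, Complex.ofReal_im, sub_zero]
    exact w.im_pos
  have hW0 := ne_zero_of_im_pos hWim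
  rw [← mul_cpow_of_im_pos_of_im_neg, autFactor_mul_smul_sub σ hq, hqe]
  rotate_left
  · rw [Complex.sub_im, Complex.ofReal_im, sub_zero]
    exact im_pos _
  · rw [im_autFactor]
    exact mul_neg_of_neg_of_pos hc w.im_pos
  rw [kernelFactor, hca]
  rcases lt_or_gt_of_ne hx with h | h
  · have hu : 0 < x₀ - x := by linarith
    have hprod : 0 < -σ 1 0 * (x₀ - x) := mul_pos hc' hu
    have e1 : ((-σ 1 0 * (x - x₀) : ℝ) : ℂ) * W = ((-σ 1 0 * (x₀ - x) : ℝ) : ℂ) * (-W) := by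
      push_cast
      ring
    have e2 : |x - x₀| = x₀ - x := by rw [abs_sub_comm, abs_of_pos hu]
    have e3 : ((x - x₀ : ℝ) : ℂ) ^ (-r : ℂ)
        = (((x₀ - x) ^ (-r) : ℝ) : ℂ) * Complex.exp (Real.pi * Complex.I * (-r)) := by
      rw [Complex.ofReal_cpow_of_nonpos (by linarith), Complex.ofReal_cpow hu.le]
      push_cast
      ring_nf
    have e4 : Complex.exp (-(Real.pi * Complex.I * ((r - 2 : ℝ) : ℂ)))
        = Complex.exp (Real.pi * Complex.I * (-r)) := by
      rw [Complex.exp_eq_exp_iff_exists_int]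
      exact ⟨1, by push_cast; ring⟩
    have e5 : (-σ 1 0 * (x₀ - x)) ^ (r - 2)
        = (-σ 1 0) ^ (r - 2) * ((x₀ - x) ^ (2 * (r - 1)) * (x₀ - x) ^ (-r)) := by
      rw [Real.mul_rpow hc'.le hu.le, ← Real.rpow_add hu]
      congr 2
      ring
    rw [e1, ofReal_mul_cpow hprod (neg_ne_zero.2 hW0), neg_cpow_of_im_pos hWim, e2, e3, e4,
      ← Complex.ofReal_cpow hprod.le, e5]
    push_cast
    ring
  · have hu : 0 < x - x₀ := by linarith
    have hprod : 0 < -σ 1 0 * (x - x₀) := mul_pos hc' hu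
    have e3 : ((x - x₀ : ℝ) : ℂ) ^ (-r : ℂ) = (((x - x₀) ^ (-r) : ℝ) : ℂ) := by
      rw [Complex.ofReal_cpow hu.le, Complex.ofReal_neg]
    have e5 : (-σ 1 0 * (x - x₀)) ^ (r - 2)
        = (-σ 1 0) ^ (r - 2) * ((x - x₀) ^ (2 * (r - 1)) * (x - x₀) ^ (-r)) := by
      rw [Real.mul_rpow hc'.le hu.le, ← Real.rpow_add hu]
      congr 2
      ring
    rw [ofReal_mul_cpow hprod hW0, abs_of_pos hu, e3, ← Complex.ofReal_cpow hprod.le, e5]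
    push_cast
    ring

/-- The Jacobian j^(-2) of w ↦ σw and the j^(2-r) released by the kernel combine to j^(-r), turning
f(σw) into f^σ(w). -/
theorem hasDerivAt_comp_smul {r : ℝ} {f : ℍ → ℂ} {σ : SL(2, ℝ)} (hc : σ 1 0 < 0) {x x₀ : ℝ}
    (hx₀ : x₀ * σ 1 0 = σ 0 0) (hx : x ≠ x₀) {P : ℂ → ℂ}
    (hP : ∀ z : ℂ, 0 < z.im →
      HasDerivAt P ((z - x) ^ ((r - 2 : ℝ) : ℂ) * f (ofComplex z)) z) {w : ℂ} (hw : 0 < w.im) :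
    HasDerivAt (fun w : ℂ => P ((σ • ofComplex w : ℍ) : ℂ))
      (kernelFactor r (σ 1 0) (x - x₀) *
        ((w - (moebius σ⁻¹ x : ℝ)) ^ ((r - 2 : ℝ) : ℂ) * slash r σ f (ofComplex w))) w := by
  refine ((hP _ (σ • ofComplex w : ℍ).im_pos).comp w (hasDerivAt_smul σ hw)).congr_deriv ?_
  have hj := autFactor_ne_zero σ (ofComplex w)
  have hk := kernel_transform (r := r) hc hx₀ hx (ofComplex w)
  have hwc : ((ofComplex w : ℍ) : ℂ) = w := by rw [ofComplex_apply_of_im_pos hw]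
  rw [hwc] at hk
  rw [ofComplex_apply, ← mul_assoc, ← hk, slash, Complex.ofReal_sub, Complex.cpow_sub _ _ hj,
    Complex.ofReal_ofNat, Complex.cpow_ofNat]
  have : autFactor σ (ofComplex w) ^ (r : ℂ) ≠ 0 := by
    rw [Complex.cpow_ne_zero_iff]
    exact Or.inl hj
  field_simp

/-- The image under `σ` of a vertical ray at its real endpoint. -/
theorem smul_vertical_re_im {σ : SL(2, ℝ)} {x s : ℝ} (hq : -σ 1 0 * x + σ 0 0 ≠ 0) (hs : 0 < s) :
    (σ • ofComplex ((moebius σ⁻¹ x : ℝ) + s * Complex.I)).im *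
        (1 + ((-σ 1 0 * x + σ 0 0) * σ 1 0 * s) ^ 2) = (-σ 1 0 * x + σ 0 0) ^ 2 * s ∧
    (σ • ofComplex ((moebius σ⁻¹ x : ℝ) + s * Complex.I)).re - x =
      (-σ 1 0 * x + σ 0 0) * σ 1 0 * s *
        (σ • ofComplex ((moebius σ⁻¹ x : ℝ) + s * Complex.I)).im := by
  set q := -σ 1 0 * x + σ 0 0 with hqdef
  set w := ofComplex ((moebius σ⁻¹ x : ℝ) + s * Complex.I) with hw
  have hwc : (w : ℂ) = (moebius σ⁻¹ x : ℝ) + s * Complex.I := coe_ofComplex_add hs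
  have hdet := det_eq_one σ
  have hp : q * (σ 1 0 * moebius σ⁻¹ x + σ 1 1) = 1 := by
    rw [moebius_inv, ← hqdef]
    field_simp
    rw [hqdef]
    linear_combination hdet
  have h := autFactor_mul_smul_sub σ hq w
  rw [← hqdef, autFactor, hwc] at h
  have hre := congr_arg Complex.re h
  have him := congr_arg Complex.im h
  simp only [Complex.mul_re, Complex.mul_im, Complex.sub_re, Complex.sub_im, Complex.add_re,
    Complex.add_im, Complex.ofReal_re, Complex.ofReal_im, Complex.I_re, Complex.I_im, coe_re,
    coe_im] at hre him
  ring_nf at hre him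
  set X := (σ • w).re
  set Y := (σ • w).im
  have hX : X - x = q * σ 1 0 * s * Y := by
    linear_combination q * hre - (X - x) * hp
  refine ⟨?_, hX⟩
  linear_combination q * him - Y * hp - q * σ 1 0 * s * hX

theorem hasDerivAt_vertical {P Φ : ℂ → ℂ} (hP : ∀ z : ℂ, 0 < z.im → HasDerivAt P (Φ z) z)
    (x : ℝ) {t : ℝ} (ht : 0 < t) :
    HasDerivAt (fun t : ℝ => P (x + t * Complex.I)) (Φ (x + t * Complex.I) * Complex.I) t := by
  have h1 : HasDerivAt (fun t : ℝ => (x : ℂ) + t * Complex.I) Complex.I t := by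
    have := ((Complex.ofRealCLM.hasDerivAt (x := t)).mul_const Complex.I).const_add (x : ℂ)
    refine this.congr_deriv ?_
    simp
  exact (hP (x + t * Complex.I) (by simpa using ht)).comp t h1

/-- The primitive of `(z - x) ^ (r - 2) f z` has the same limit at `x` along the vertical ray and
along the image of a vertical ray under `σ`. -/
theorem tendsto_primitive_sub_at_endpoint {r : ℝ} (hr : 2 < r) {f : ℍ → ℂ} {C : ℝ}
    (hC : ∀ z : ℍ, ‖f z‖ ≤ C * z.im ^ (-(r / 2))) {σ : SL(2, ℝ)} {x : ℝ}
    (hq : -σ 1 0 * x + σ 0 0 ≠ 0) {P : ℂ → ℂ}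
    (hP : ∀ z : ℂ, 0 < z.im →
      HasDerivAt P ((z - x) ^ ((r - 2 : ℝ) : ℂ) * f (ofComplex z)) z)
    {s : ℕ → ℝ} (hs0 : ∀ᶠ n in atTop, 0 < s n) (hs : Tendsto s atTop (𝓝 0)) :
    Tendsto (fun n => (σ • ofComplex ((moebius σ⁻¹ x : ℝ) + s n * Complex.I)).im) atTop (𝓝 0) ∧
    Tendsto (fun n => P ((σ • ofComplex ((moebius σ⁻¹ x : ℝ) + s n * Complex.I) : ℍ) : ℂ) -
      P (x + (σ • ofComplex ((moebius σ⁻¹ x : ℝ) + s n * Complex.I)).im * Complex.I)) atTop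
      (𝓝 0) := by
  set q := -σ 1 0 * x + σ 0 0 with hqdef
  set L := |q * σ 1 0| with hL
  set ε : ℕ → ℝ := fun n => (σ • ofComplex ((moebius σ⁻¹ x : ℝ) + s n * Complex.I)).im with hε
  have hε0 : ∀ n, 0 < ε n := fun n => im_pos _
  have hεlim : Tendsto ε atTop (𝓝 0) := by
    have h1 : Tendsto (fun n => q ^ 2 * s n) atTop (𝓝 0) := by simpa using hs.const_mul (q ^ 2)
    refine squeeze_zero' (Eventually.of_forall fun n => (hε0 n).le) ?_ h1
    filter_upwards [hs0] with n hn
    have h2 := (smul_vertical_re_im hq hn).1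
    rw [← hqdef] at h2
    rw [← h2]
    exact le_mul_of_one_le_right (hε0 n).le (by nlinarith [sq_nonneg (q * σ 1 0 * s n)])
  refine ⟨hεlim, ?_⟩
  -- At height ε the horizontal gap between the two paths is at most Lε. On it the kernel is
  -- O(ε^(r-2)) and f is O(ε^(-r/2)), so the primitive changes by O(ε^(r/2-1)), which vanishes in
  -- the limit because r > 2.
  have hbd : Tendsto (fun n => (L + 1) ^ (r - 2) * C * L * ε n ^ (r / 2 - 1)) atTop (𝓝 0) := by
    have h1 := hεlim.rpow_const (p := r / 2 - 1) (Or.inr (by linarith))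
    rw [Real.zero_rpow (by linarith)] at h1
    simpa using h1.const_mul ((L + 1) ^ (r - 2) * C * L)
  refine squeeze_zero_norm' ?_ hbd
  filter_upwards [hs0, hs.eventually_lt_const one_pos] with n hn hn1
  set z := σ • ofComplex ((moebius σ⁻¹ x : ℝ) + s n * Complex.I) with hz
  have hre := (smul_vertical_re_im hq hn).2
  rw [← hqdef, ← hz] at hre
  have hη : |z.re - x| ≤ L * ε n := by
    rw [hre, abs_mul, abs_of_pos (hε0 n)]
    gcongr
    rw [abs_mul, abs_of_pos hn]
    exact mul_le_of_le_one_right (abs_nonneg _) hn1.le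
  have hzc : (z : ℂ) = z.re + ε n * Complex.I := by
    apply Complex.ext <;> simp [hε, hz]
  have hL0 : 0 ≤ L := abs_nonneg _
  have hC0 : 0 ≤ C := by
    have := (norm_nonneg _).trans (hC UpperHalfPlane.I)
    simpa using this
  rw [hzc]
  refine (norm_sub_le_of_horizontal hP (hε0 n)
    (B := ((L + 1) * ε n) ^ (r - 2) * (C * ε n ^ (-(r / 2)))) fun ξ hξ => ?_).trans ?_
  · have hξx : |ξ - x| ≤ L * ε n := by
      refine le_trans ?_ hη
      rw [abs_le]
      have e1 := abs_nonneg (z.re - x)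
      have e2 := abs_le.1 (le_refl |z.re - x|)
      rcases Set.mem_uIcc.1 hξ with h | h <;> constructor <;> linarith [h.1, h.2]
    rw [norm_mul]
    have h1 := hC (ofComplex (ξ + ε n * Complex.I))
    rw [im_ofComplex_add (hε0 n)] at h1
    have h2 := norm_add_mul_I_cpow_le (ξ := ξ) (x := x) (s := r - 2) (by linarith) (hε0 n) hξx
    rw [show L * ε n + ε n = (L + 1) * ε n by ring] at h2
    gcongr
  · calc _ ≤ ((L + 1) * ε n) ^ (r - 2) * (C * ε n ^ (-(r / 2))) * (L * ε n) := by
          have := (hε0 n).le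
          gcongr
      _ = (L + 1) ^ (r - 2) * C * L * (ε n ^ (r - 2) * ε n ^ (-(r / 2)) * ε n ^ (1 : ℝ)) := by
          rw [Real.mul_rpow (by positivity) (hε0 n).le, Real.rpow_one]
          ring
      _ = _ := by
          rw [← Real.rpow_add (hε0 n), ← Real.rpow_add (hε0 n)]
          ring_nf

/-- The geodesic from the pole -d/c of σ to ∞ goes to the one from ∞ to x₀, which is again vertical
but traversed in reverse. Behaviour of f at the cusp x₀ is thereby read off from f^σ at i∞. -/
theorem coe_smul_vertical_pole {σ : SL(2, ℝ)} (hc : σ 1 0 < 0) {x₀ : ℝ}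
    (hx₀ : x₀ * σ 1 0 = σ 0 0) {t : ℝ} (ht : 0 < t) :
    ((σ • ofComplex ((-σ 1 1 / σ 1 0 : ℝ) + t * Complex.I) : ℍ) : ℂ)
      = x₀ + (1 / (σ 1 0 ^ 2 * t) : ℝ) * Complex.I := by
  have hdet := det_eq_one σ
  have hcc : (σ 1 0 : ℂ) ≠ 0 := by exact_mod_cast hc.ne
  have htc : (t : ℂ) ≠ 0 := by exact_mod_cast ht.ne'
  have hdet' : (σ 0 0 : ℂ) * σ 1 1 - σ 0 1 * σ 1 0 = 1 := by exact_mod_cast hdet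
  have hx₀' : (x₀ : ℂ) * σ 1 0 = σ 0 0 := by exact_mod_cast hx₀
  rw [coe_smul_real, autFactor, coe_ofComplex_add ht]
  have hden : (σ 1 0 : ℂ) * ((-σ 1 1 / σ 1 0 : ℝ) + t * Complex.I) + σ 1 1
      = σ 1 0 * t * Complex.I := by
    push_cast
    field_simp
    ring
  rw [hden, div_eq_iff (by simp [hcc, htc])]
  push_cast
  field_simp
  linear_combination (-(σ 1 0 * t * Complex.I)) * hx₀' - hdet' - Complex.I_sq

/-- The contour shift behind the functional equation. -/
theorem integral_eichler_eq {r : ℝ} (hr : 2 < r) {f : ℍ → ℂ}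
    (hol : DifferentiableOn ℂ (f ∘ ofComplex) {z : ℂ | 0 < z.im}) {C : ℝ}
    (hC : ∀ z : ℍ, ‖f z‖ ≤ C * z.im ^ (-(r / 2)))
    {D δ Y : ℝ} (hδ : 0 < δ) (hf : ∀ z : ℍ, Y ≤ z.im → ‖f z‖ ≤ D * Real.exp (-δ * z.im))
    {σ : SL(2, ℝ)} (hc : σ 1 0 < 0) {D' δ' Y' : ℝ} (hδ' : 0 < δ')
    (hg : ∀ z : ℍ, Y' ≤ z.im → ‖slash r σ f z‖ ≤ D' * Real.exp (-δ' * z.im))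
    {x x₀ : ℝ} (hx₀ : x₀ * σ 1 0 = σ 0 0) (hx : x ≠ x₀)
    (h0 : IntegrableOn (eichlerIntegrand r f x₀ x) (Set.Ioi 0))
    (h1 : IntegrableOn (eichlerIntegrand r f x x) (Set.Ioi 0))
    (h2 : IntegrableOn (eichlerIntegrand r (slash r σ f) (moebius σ⁻¹ x) (moebius σ⁻¹ x))
      (Set.Ioi 0)) :
    ∫ t in Set.Ioi (0 : ℝ), eichlerIntegrand r f x₀ x t =
      (∫ t in Set.Ioi (0 : ℝ), eichlerIntegrand r f x x t) -
        kernelFactor r (σ 1 0) (x - x₀) * ∫ t in Set.Ioi (0 : ℝ),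
          eichlerIntegrand r (slash r σ f) (moebius σ⁻¹ x) (moebius σ⁻¹ x) t := by
  set y := moebius σ⁻¹ x with hy
  set K := kernelFactor r (σ 1 0) (x - x₀) with hK
  have hr2 : 0 < r - 2 := by linarith
  have hq : -σ 1 0 * x + σ 0 0 ≠ 0 := by
    rw [show -σ 1 0 * x + σ 0 0 = -σ 1 0 * (x - x₀) by linear_combination -hx₀]
    exact mul_ne_zero (by linarith) (sub_ne_zero.2 hx)
  have hΦ : DifferentiableOn ℂ (fun z : ℂ => (z - x) ^ ((r - 2 : ℝ) : ℂ) * f (ofComplex z))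
      {z : ℂ | 0 < z.im} := by
    refine DifferentiableOn.mul (DifferentiableOn.cpow_const
      (Differentiable.differentiableOn (by fun_prop)) fun z hz => Or.inr ?_) hol
    rw [Complex.sub_im, Complex.ofReal_im, sub_zero]
    exact ne_of_gt hz
  obtain ⟨P, hP⟩ := exists_primitive_upperHalfPlane hΦ
  set Q : ℂ → ℂ := fun w => P ((σ • ofComplex w : ℍ) : ℂ) with hQdef
  have hQ : ∀ w : ℂ, 0 < w.im → HasDerivAt Q
      (K * ((w - y) ^ ((r - 2 : ℝ) : ℂ) * slash r σ f (ofComplex w))) w := fun w hw =>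
    hasDerivAt_comp_smul hc hx₀ hx hP hw
  set s : ℕ → ℝ := fun n => 1 / (n : ℝ) with hs
  have hs0 : ∀ᶠ n in atTop, 0 < s n := by
    filter_upwards [eventually_gt_atTop 0] with n hn
    simp only [hs]
    positivity
  have hslim : Tendsto s atTop (𝓝 0) := tendsto_one_div_atTop_nhds_zero_nat
  obtain ⟨hεlim, hE⟩ := tendsto_primitive_sub_at_endpoint hr hC hq hP hs0 hslim
  rw [← hy] at hεlim hE
  set ε : ℕ → ℝ := fun n => (σ • ofComplex ((y : ℂ) + s n * Complex.I)).im with hε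
  have hcat : Tendsto (fun n : ℕ => (n : ℝ)) atTop atTop := tendsto_natCast_atTop_atTop
  have lim0 : Tendsto _ atTop (𝓝 (∫ t in Set.Ioi (0 : ℝ), eichlerIntegrand r f x₀ x t)) :=
    tendsto_sub_integral_Ioi (fun t ht => hasDerivAt_vertical hP x₀ ht) h0
    -- This cut-off above x₀ is the image under σ of height n above the pole, so that it can be
    -- compared with height n above y.
    (a := fun n : ℕ => 1 / (σ 1 0 ^ 2 * n)) (by
      filter_upwards [eventually_gt_atTop 0] with n hn
      have : 0 < σ 1 0 ^ 2 := by nlinarith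
      positivity) (by
      have := hslim.const_mul (1 / σ 1 0 ^ 2)
      rw [mul_zero] at this
      refine this.congr fun n => ?_
      simp only [hs]
      rw [one_div_mul_one_div]) hcat
  have lim1 : Tendsto _ atTop (𝓝 (∫ t in Set.Ioi (0 : ℝ), eichlerIntegrand r f x x t)) :=
    tendsto_sub_integral_Ioi (fun t ht => hasDerivAt_vertical hP x ht) h1
    (Eventually.of_forall fun n => (im_pos _ : 0 < ε n)) hεlim hcat
  have hQint : IntegrableOn (fun t : ℝ => K * (((y : ℂ) + t * Complex.I - y) ^ ((r - 2 : ℝ) : ℂ) *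
      slash r σ f (ofComplex (y + t * Complex.I))) * Complex.I) (Set.Ioi 0) := by
    refine Integrable.congr (h2.const_mul K) (Eventually.of_forall fun t => ?_)
    simp only [eichlerIntegrand]
    ring
  have lim2 := tendsto_sub_integral_Ioi (fun t ht => hasDerivAt_vertical hQ y ht) hQint hs0 hslim
    hcat
  have hI2 : ∫ t in Set.Ioi (0 : ℝ), K * (((y : ℂ) + t * Complex.I - y) ^ ((r - 2 : ℝ) : ℂ) *
      slash r σ f (ofComplex (y + t * Complex.I))) * Complex.I
      = K * ∫ t in Set.Ioi (0 : ℝ), eichlerIntegrand r (slash r σ f) y y t := by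
    rw [← integral_const_mul]
    refine integral_congr_ae (Eventually.of_forall fun t => ?_)
    simp only [eichlerIntegrand]
    ring
  rw [hI2] at lim2
  -- The three truncated integrals close up to three gaps, each tending to 0: between x and x₀ at
  -- height n, near x between the ray and the image curve, and near x₀. The last one is a horizontal
  -- gap at height n in the coordinate w.
  have hA := tendsto_horizontal_sub (k := 1) hr2.le (fun z hz => by
    rw [one_mul]; exact hP z hz) hδ hf x x₀
  have hB := tendsto_horizontal_sub hr2.le hQ hδ' hg (-σ 1 1 / σ 1 0) y
  have hsum := (lim0.sub lim1).add lim2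
  have hzero := (hA.sub hE).add hB
  simp only [sub_zero, add_zero] at hzero
  have hlim := tendsto_nhds_unique hsum (hzero.congr' ?_)
  · rw [sub_add] at hlim
    linear_combination hlim
  · filter_upwards [eventually_gt_atTop 0] with n hn
    have hn' : (0 : ℝ) < n := by exact_mod_cast hn
    simp only [hQdef]
    rw [coe_smul_vertical_pole hc hx₀ hn']
    ring

/-! ### Fractional integrals as Eichler integrals -/

theorem eichlerIntegrand_self {r : ℝ} (g : ℍ → ℂ) (y : ℝ) {t : ℝ} (ht : 0 < t) :
    eichlerIntegrand r g y y t = Complex.I ^ ((r - 1 : ℝ) : ℂ) *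
      (((t ^ (r - 1 - 1) : ℝ) : ℂ) * g (ofComplex (y + t * Complex.I))) := by
  have h1 : Complex.I ^ ((r - 1 : ℝ) : ℂ) = Complex.I ^ ((r - 2 : ℝ) : ℂ) * Complex.I := by
    rw [show ((r - 1 : ℝ) : ℂ) = ((r - 2 : ℝ) : ℂ) + 1 by push_cast; ring,
      Complex.cpow_add _ _ Complex.I_ne_zero, Complex.cpow_one]
  rw [eichlerIntegrand, add_sub_cancel_left, ofReal_mul_cpow ht Complex.I_ne_zero,
    ← Complex.ofReal_cpow ht.le, h1, show r - 1 - 1 = r - 2 by ring]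
  ring

theorem integrableOn_eichlerIntegrand_self {r : ℝ} {g : ℍ → ℂ} {y : ℝ}
    (h : IntegrableOn (fun t : ℝ => ((t ^ (r - 1 - 1) : ℝ) : ℂ) * g (ofComplex (y + t * Complex.I)))
      (Set.Ioi 0)) :
    IntegrableOn (eichlerIntegrand r g y y) (Set.Ioi 0) :=
  IntegrableOn.congr_fun (h.const_mul (Complex.I ^ ((r - 1 : ℝ) : ℂ)))
    (fun _ ht => (eichlerIntegrand_self g y ht).symm) measurableSet_Ioi

theorem integral_eichlerIntegrand_self (r : ℝ) (g : ℍ → ℂ) (y : ℝ) :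
    ∫ t in Set.Ioi (0 : ℝ), eichlerIntegrand r g y y t = Complex.I ^ ((r - 1 : ℝ) : ℂ) *
      ∫ t in Set.Ioi (0 : ℝ), ((t ^ (r - 1 - 1) : ℝ) : ℂ) * g (ofComplex (y + t * Complex.I)) := by
  rw [← integral_const_mul]
  exact setIntegral_congr_fun measurableSet_Ioi fun _ ht => eichlerIntegrand_self g y ht

theorem dilate_one (g : ℍ → ℂ) : dilate 1 g = g := by
  ext z
  rw [dilate, Nat.cast_one, one_mul, ofComplex_apply]

theorem dilate_vertical {m : ℕ} (hm : 0 < m) (g : ℍ → ℂ) (x : ℝ) {t : ℝ} (ht : 0 < t) :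
    dilate m g (ofComplex ((x / m : ℝ) + t * Complex.I)) =
      g (ofComplex (x + (m * t : ℝ) * Complex.I)) := by
  have hm' : (m : ℂ) ≠ 0 := by exact_mod_cast hm.ne'
  rw [dilate, coe_ofComplex_add ht]
  congr 2
  push_cast
  field_simp

/-- The value of the fractional integral as a Mellin transform along a vertical ray. -/
theorem tendsto_fracPartialSum {m : ℕ} (hm : 0 < m) {g : ℍ → ℂ} {β C α : ℝ}
    (h : IsTwistedForm (cuspParam (dilate m g)) β C (dilate m g)) (hα : β < α) (x : ℝ) :
    IntegrableOn (fun t : ℝ => ((t ^ (α - 1) : ℝ) : ℂ) * g (ofComplex (x + t * Complex.I)))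
      (Set.Ioi 0) ∧
    Tendsto (fun N : ℕ => fracPartialSum m g α N x) atTop
      (𝓝 ((((2 * Real.pi) ^ α / (Real.Gamma α * m ^ α) : ℝ) : ℂ) *
        ∫ t in Set.Ioi (0 : ℝ), ((t ^ (α - 1) : ℝ) : ℂ) * g (ofComplex (x + t * Complex.I)))) := by
  obtain ⟨h1, h2⟩ := h.tendsto_fracSum hα (x / m)
  have hm' : (0 : ℝ) < m := by exact_mod_cast hm
  set G : ℝ → ℂ := fun t => ((t ^ (α - 1) : ℝ) : ℂ) * g (ofComplex (x + t * Complex.I)) with hG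
  have hα1 : (m : ℝ) ^ (α - 1) ≠ 0 := (Real.rpow_pos_of_pos hm' _).ne'
  have hfun : ∀ t ∈ Set.Ioi (0 : ℝ), ((t ^ (α - 1) : ℝ) : ℂ) *
      dilate m g (ofComplex ((x / m : ℝ) + t * Complex.I)) =
      (((m : ℝ) ^ (α - 1))⁻¹ : ℝ) * G (m * t) := fun t ht => by
    have ht0 : 0 < t := ht
    have hα1' : (((m : ℝ) ^ (α - 1) : ℝ) : ℂ) ≠ 0 := by exact_mod_cast hα1
    simp only [hG]
    rw [dilate_vertical hm g x ht0, Real.mul_rpow hm'.le ht0.le]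
    push_cast
    field_simp
  have hint : IntegrableOn (fun t => G (m * t)) (Set.Ioi 0) := by
    have h3 := (h1.congr_fun hfun measurableSet_Ioi).const_mul (((m : ℝ) ^ (α - 1) : ℝ) : ℂ)
    refine h3.congr (Eventually.of_forall fun t => ?_)
    simp only
    rw [← mul_assoc, ← Complex.ofReal_mul, mul_inv_cancel₀ hα1, Complex.ofReal_one, one_mul]
  constructor
  · have := (integrableOn_Ioi_comp_mul_left_iff G 0 hm').1 hint
    rwa [mul_zero] at this
  · rw [setIntegral_congr_fun measurableSet_Ioi hfun, integral_const_mul,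
      integral_comp_mul_left_Ioi G 0 hm', mul_zero] at h2
    have hval : (((2 * Real.pi) ^ α / (Real.Gamma α * m ^ α) : ℝ) : ℂ) *
        (∫ t in Set.Ioi (0 : ℝ), G t) = (((2 * Real.pi) ^ α / Real.Gamma α : ℝ) : ℂ) *
        ((((m : ℝ) ^ (α - 1))⁻¹ : ℝ) * ((m : ℝ)⁻¹ • ∫ t in Set.Ioi (0 : ℝ), G t)) := by
      rw [Complex.real_smul, ← mul_assoc, ← mul_assoc, ← Complex.ofReal_mul, ← Complex.ofReal_mul]
      congr 2
      rw [Real.rpow_sub_one hm'.ne']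
      field_simp
    rw [hval]
    refine h2.congr fun N => ?_
    rw [fracPartialSum]
    refine Finset.sum_congr rfl fun n _ => ?_
    rw [fourierCoef_eq_twistedCoef h.twist h.holo h.bounded, Complex.ofReal_div,
      Complex.ofReal_natCast]

/-- Exponential decay of `g`, given a Fourier expansion of its dilation. -/
theorem exists_norm_le_exp_of_dilate {m : ℕ} (hm : 0 < m) {g : ℍ → ℂ} {κ β C : ℝ}
    (h : IsTwistedForm κ β C (dilate m g)) :
    ∃ D δ : ℝ, 0 < δ ∧ ∀ z : ℍ, m ≤ z.im → ‖g z‖ ≤ D * Real.exp (-δ * z.im) := by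
  obtain ⟨D, δ, hδ, hD⟩ := h.exists_norm_le_exp
  have hm' : (0 : ℝ) < m := by exact_mod_cast hm
  refine ⟨D, δ / m, by positivity, fun z hz => ?_⟩
  have ht : 0 < z.im / m := div_pos z.im_pos hm'
  have h1 := hD (ofComplex ((z.re / m : ℝ) + (z.im / m : ℝ) * Complex.I))
    (by rw [im_ofComplex_add ht]; rwa [one_le_div hm'])
  have h2 : (z.re : ℂ) + z.im * Complex.I = z := by apply Complex.ext <;> simp
  rw [dilate_vertical hm g _ ht, im_ofComplex_add ht, mul_div_cancel₀ _ hm'.ne', h2,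
    ofComplex_apply] at h1
  convert h1 using 3
  ring

/-! ### Absolute convergence and the polynomial case -/

/-- A cusp form decays exponentially at both ends of a vertical ray that starts at a cusp. -/
theorem exists_norm_vertical_le_exp {r : ℝ} (hr : 0 < r) {f : ℍ → ℂ} {C : ℝ}
    (hC : ∀ z : ℍ, ‖f z‖ ≤ C * z.im ^ (-(r / 2)))
    {D δ Y : ℝ} (hδ : 0 < δ) (hf : ∀ z : ℍ, Y ≤ z.im → ‖f z‖ ≤ D * Real.exp (-δ * z.im))
    {σ : SL(2, ℝ)} (hc : σ 1 0 < 0) {D' δ' Y' : ℝ} (hδ' : 0 < δ')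
    (hg : ∀ z : ℍ, Y' ≤ z.im → ‖slash r σ f z‖ ≤ D' * Real.exp (-δ' * z.im))
    {x₀ : ℝ} (hx₀ : x₀ * σ 1 0 = σ 0 0) :
    ∃ M : ℝ, ∀ t : ℝ, 0 < t →
      ‖f (ofComplex (x₀ + t * Complex.I))‖ ≤ M * Real.exp (-δ * t) := by
  have hc2 : 0 < σ 1 0 ^ 2 := by nlinarith
  -- With s = 1/(c^2 t), |f(x₀ + it)| equals |c|^r s^r times |f^σ| at height s above the pole. The
  -- decay of f^σ absorbs s^r, and boundedness near t = 0 is all that the estimate retains.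
  obtain ⟨S, hS⟩ : ∃ S : ℝ, ∀ s, S ≤ s → s ^ r * Real.exp (-δ' * s) ≤ 1 :=
    eventually_atTop.1 ((tendsto_rpow_mul_exp_neg_mul_atTop_nhds_zero r δ' hδ').eventually_le_const
      one_pos)
  set Y₁ := max 1 (max Y' S) with hY₁
  have hY₁0 : 0 < Y₁ := lt_max_of_lt_left one_pos
  set a := 1 / (σ 1 0 ^ 2 * Y₁) with ha
  have ha0 : 0 < a := by positivity
  set M₁ := |D'| * (σ 1 0 ^ 2) ^ (r / 2) with hM₁
  set M₂ := |C| * a ^ (-(r / 2)) with hM₂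
  have hM₁0 : 0 ≤ M₁ := by positivity
  have hM₂0 : 0 ≤ M₂ := by positivity
  have hsmall : ∀ t : ℝ, 0 < t → ‖f (ofComplex (x₀ + t * Complex.I))‖ ≤ M₁ + M₂ := by
    intro t ht
    rcases le_total t a with hta | hta
    · refine le_add_of_le_of_nonneg ?_ hM₂0
      set s := 1 / (σ 1 0 ^ 2 * t) with hs
      have hs0 : 0 < s := by positivity
      have hsY : Y₁ ≤ s := by
        rw [hs, le_div_iff₀ (by positivity)]
        rw [ha, le_div_iff₀ (by positivity)] at hta
        linarith
      set w := ofComplex ((-σ 1 1 / σ 1 0 : ℝ) + s * Complex.I) with hw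
      have hwim : w.im = s := im_ofComplex_add hs0
      have hst : 1 / (σ 1 0 ^ 2 * s) = t := by
        have hc0 := hc.ne
        rw [hs]
        field_simp
      have hpole := coe_smul_vertical_pole hc hx₀ hs0
      rw [← hw, hst] at hpole
      have h1 : ofComplex (x₀ + t * Complex.I) = σ • w := by
        rw [← hpole, ofComplex_apply]
      have him : (σ • w).im = t := by rw [← h1, im_ofComplex_add ht]
      have h2 := norm_slash r σ f w
      rw [him, hwim, ← h1] at h2
      have hst' : s = σ 1 0 ^ 2 * s ^ 2 * t := by
        rw [hs]
        field_simp
      have h3 : s ^ (r / 2) = (σ 1 0 ^ 2) ^ (r / 2) * s ^ r * t ^ (r / 2) := by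
        conv_lhs => rw [hst']
        rw [Real.mul_rpow (by positivity) ht.le, Real.mul_rpow (by positivity) (by positivity),
          ← Real.rpow_natCast s, ← Real.rpow_mul hs0.le]
        congr 3
        push_cast
        ring
      have ht' : 0 < t ^ (r / 2) := Real.rpow_pos_of_pos ht _
      rw [h3, ← mul_assoc] at h2
      rw [← mul_right_cancel₀ ht'.ne' h2]
      have h4 := hg w (by rw [hwim]; exact ((le_max_left _ _).trans (le_max_right _ _)).trans hsY)
      rw [hwim] at h4
      have h5 := hS s (((le_max_right _ _).trans (le_max_right _ _)).trans hsY)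
      calc ‖slash r σ f w‖ * ((σ 1 0 ^ 2) ^ (r / 2) * s ^ r)
          ≤ (|D'| * Real.exp (-δ' * s)) * ((σ 1 0 ^ 2) ^ (r / 2) * s ^ r) := by
            gcongr
            refine h4.trans ?_
            gcongr
            exact le_abs_self D'
        _ = M₁ * (s ^ r * Real.exp (-δ' * s)) := by rw [hM₁]; ring
        _ ≤ M₁ := mul_le_of_le_one_right hM₁0 h5
    · refine le_add_of_nonneg_of_le hM₁0 ?_
      have h1 := hC (ofComplex (x₀ + t * Complex.I))
      rw [im_ofComplex_add ht] at h1
      refine h1.trans ?_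
      have h2 : t ^ (-(r / 2)) ≤ a ^ (-(r / 2)) :=
        Real.rpow_le_rpow_of_nonpos ha0 hta (by linarith)
      calc C * t ^ (-(r / 2)) ≤ |C| * t ^ (-(r / 2)) := by
            gcongr
            exact le_abs_self C
        _ ≤ M₂ := by rw [hM₂]; gcongr
  refine ⟨(M₁ + M₂) * Real.exp (δ * |Y|) + |D|, fun t ht => ?_⟩
  rw [add_mul]
  rcases le_total Y t with hY | hY
  · refine le_add_of_nonneg_of_le (by positivity) ?_
    have h1 := hf (ofComplex (x₀ + t * Complex.I)) (by rwa [im_ofComplex_add ht])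
    rw [im_ofComplex_add ht] at h1
    refine h1.trans ?_
    gcongr
    exact le_abs_self D
  · refine le_add_of_le_of_nonneg ((hsmall t ht).trans ?_) (by positivity)
    rw [mul_assoc, ← Real.exp_add]
    refine le_mul_of_one_le_right (by positivity) (Real.one_le_exp ?_)
    have := hY.trans (le_abs_self Y)
    nlinarith

/-- The Eichler integral converges absolutely. -/
theorem integrableOn_eichlerIntegrand {r : ℝ} (hr : 2 ≤ r) {f : ℍ → ℂ}
    (hol : DifferentiableOn ℂ (f ∘ ofComplex) {z : ℂ | 0 < z.im}) {x₀ M δ : ℝ} (hδ : 0 < δ)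
    (hM : ∀ t : ℝ, 0 < t → ‖f (ofComplex (x₀ + t * Complex.I))‖ ≤ M * Real.exp (-δ * t)) (x : ℝ) :
    IntegrableOn (eichlerIntegrand r f x₀ x) (Set.Ioi 0) := by
  have hmaj : IntegrableOn (fun t : ℝ => (|x₀ - x| + t) ^ (r - 2) * (M * Real.exp (-δ * t)))
      (Set.Ioi 0) := by
    -- Half of the decay rate is spent on dominating the power.
    refine integrable_of_isBigO_exp_neg (b := δ / 2) (by positivity) ?_ ?_
    · refine Continuous.continuousOn ?_
      exact ((continuous_const.add continuous_id).rpow_const fun _ => Or.inr (by linarith)).mul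
        (by fun_prop)
    · have h1 : (fun t : ℝ => (|x₀ - x| + t) ^ (r - 2)) =O[atTop]
          fun t => Real.exp (δ / 2 * (|x₀ - x| + t)) :=
        (isLittleO_rpow_exp_pos_mul_atTop (r - 2) (half_pos hδ)).isBigO.comp_tendsto
          (tendsto_atTop_add_const_left _ _ tendsto_id)
      refine (h1.mul (isBigO_refl (fun t : ℝ => M * Real.exp (-δ * t)) _)).trans ?_
      refine IsBigO.of_bound (Real.exp (δ / 2 * |x₀ - x|) * |M|) (Eventually.of_forall fun t => ?_)
      rw [norm_mul, norm_mul, Real.norm_of_nonneg (Real.exp_pos _).le,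
        Real.norm_of_nonneg (Real.exp_pos _).le, Real.norm_of_nonneg (Real.exp_pos _).le,
        Real.norm_eq_abs, mul_add, Real.exp_add,
        show -δ * t = -(δ / 2) * t + -(δ / 2 * t) by ring, Real.exp_add, Real.exp_neg (δ / 2 * t)]
      refine le_of_eq ?_
      have := (Real.exp_pos (δ / 2 * t)).ne'
      field_simp
  have hΦ : DifferentiableOn ℂ (fun z : ℂ => (z - x) ^ ((r - 2 : ℝ) : ℂ) * f (ofComplex z))
      {z : ℂ | 0 < z.im} := by
    refine DifferentiableOn.mul (DifferentiableOn.cpow_const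
      (Differentiable.differentiableOn (by fun_prop)) fun z hz => Or.inr ?_) hol
    rw [Complex.sub_im, Complex.ofReal_im, sub_zero]
    exact ne_of_gt hz
  have hcont : ContinuousOn (eichlerIntegrand r f x₀ x) (Set.Ioi 0) :=
    (hΦ.continuousOn.comp (f := fun t : ℝ => (x₀ : ℂ) + t * Complex.I)
      (Continuous.continuousOn (by fun_prop)) fun t ht => by simpa using ht).mul continuousOn_const
  refine Integrable.mono' hmaj (hcont.aestronglyMeasurable measurableSet_Ioi) ?_
  refine (ae_restrict_iff' measurableSet_Ioi).2 (Eventually.of_forall fun t ht => ?_)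
  have ht0 : 0 < t := ht
  rw [eichlerIntegrand, norm_mul, norm_mul, Complex.norm_I, mul_one]
  have h1 := norm_add_mul_I_cpow_le (ξ := x₀) (x := x) (s := r - 2) (by linarith) ht0 le_rfl
  have h2 := hM t ht0
  gcongr

/-- For an integral weight, the Eichler integral is a polynomial. -/
theorem exists_polynomial_integral_eichlerIntegrand {f : ℍ → ℂ}
    {x₀ : ℝ} (hint : ∀ k : ℕ, IntegrableOn (eichlerIntegrand (k + 2) f x₀ 0) (Set.Ioi 0)) (n : ℕ) :
    ∃ P : Polynomial ℂ, P.natDegree ≤ n ∧ ∀ x : ℝ,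
      ∫ t in Set.Ioi (0 : ℝ), eichlerIntegrand (n + 2) f x₀ x t = P.eval (x : ℂ) := by
  refine ⟨∑ k ∈ Finset.range (n + 1), Polynomial.C ((∫ t in Set.Ioi (0 : ℝ),
    eichlerIntegrand (k + 2) f x₀ 0 t) * (-1) ^ (n - k) * n.choose k) * Polynomial.X ^ (n - k),
    ?_, fun x => ?_⟩
  · refine Polynomial.natDegree_sum_le_of_forall_le _ _ fun k _ => ?_
    exact (Polynomial.natDegree_C_mul_X_pow_le _ _).trans (Nat.sub_le n k)
  · have hpow : ∀ (k : ℕ) (y t : ℝ), eichlerIntegrand (k + 2) f x₀ y t =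
        ((x₀ + t * Complex.I) - y : ℂ) ^ k * f (ofComplex (x₀ + t * Complex.I)) * Complex.I := by
      intro k y t
      rw [eichlerIntegrand, add_sub_cancel_right, Complex.ofReal_natCast, Complex.cpow_natCast]
    have hexp : ∀ t : ℝ, eichlerIntegrand (n + 2) f x₀ x t = ∑ k ∈ Finset.range (n + 1),
        eichlerIntegrand (k + 2) f x₀ 0 t * ((-x) ^ (n - k) * n.choose k : ℂ) := by
      intro t
      rw [hpow, sub_eq_add_neg, add_pow, Finset.sum_mul, Finset.sum_mul]
      refine Finset.sum_congr rfl fun k _ => ?_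
      rw [hpow, Complex.ofReal_zero, sub_zero]
      ring
    simp_rw [hexp]
    rw [integral_finsetSum _ fun k _ => (hint k).mul_const _, Polynomial.eval_finsetSum]
    refine Finset.sum_congr rfl fun k _ => ?_
    rw [integral_mul_const, Polynomial.eval_C_mul, Polynomial.eval_pow, Polynomial.eval_X, neg_pow]
    ring

/-! ### Assembly of the functional equation -/

theorem smul_infty_eq_coe {γ : SL(2, ℤ)} {x₀ : ℚ}
    (h : SpecialLinearGroup.mapGL ℚ γ • (OnePoint.infty : OnePoint ℚ) = (x₀ : OnePoint ℚ)) :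
    γ 1 0 ≠ 0 ∧ x₀ * γ 1 0 = γ 0 0 := by
  have hc : γ 1 0 ≠ 0 := fun hc => by
    rw [(smul_infty_eq_iff γ).2 hc] at h
    exact OnePoint.infty_ne_coe _ h
  refine ⟨hc, ?_⟩
  have hc' : (γ 1 0 : ℚ) ≠ 0 := by exact_mod_cast hc
  rw [OnePoint.smul_infty_eq_ite] at h
  simp only [SpecialLinearGroup.mapGL_coe_matrix] at h
  simp [hc] at h
  rw [← h, div_mul_cancel₀ _ hc']

theorem valueAtInfty_eq_zero {g : ℍ → ℂ} (h : 0 < cuspParam g ∨ fourierCoef g 0 = 0) :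
    valueAtInfty g = 0 := by
  rw [valueAtInfty]
  split_ifs with hk
  · rfl
  · exact h.resolve_left hk

/-- The functional equation, for a cusp of the form `x₀` and given the values of the two
fractional integrals. -/
theorem approxError_eq_periodIntegral {Γ : Subgroup SL(2, ℤ)} {r : ℝ} (hr : 2 < r) {f : ℍ → ℂ}
    {x₀ : ℚ} {σ : SL(2, ℝ)} {m : ℕ} (hmΓ : m = cuspWidth Γ OnePoint.infty) (hm : 0 < m)
    (hv : valueAtInfty (slash r σ f) = 0)
    (hF : ∀ x : ℝ, fracIntegral m f (r - 1) x =
      (((2 * Real.pi) ^ (r - 1) / (Real.Gamma (r - 1) * m ^ (r - 1)) : ℝ) : ℂ) *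
        ∫ t in Set.Ioi (0 : ℝ), ((t ^ (r - 1 - 1) : ℝ) : ℂ) * f (ofComplex (x + t * Complex.I)))
    (hG : ∀ y : ℝ, fracIntegral 1 (slash r σ f) (r - 1) y =
      (((2 * Real.pi) ^ (r - 1) / Real.Gamma (r - 1) : ℝ) : ℂ) *
        ∫ t in Set.Ioi (0 : ℝ), ((t ^ (r - 1 - 1) : ℝ) : ℂ) *
          slash r σ f (ofComplex (y + t * Complex.I)))
    (hE : ∀ x : ℝ, x ≠ x₀ → ∫ t in Set.Ioi (0 : ℝ), eichlerIntegrand r f x₀ x t =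
      (∫ t in Set.Ioi (0 : ℝ), eichlerIntegrand r f x x t) -
        kernelFactor r (σ 1 0) (x - x₀) * ∫ t in Set.Ioi (0 : ℝ),
          eichlerIntegrand r (slash r σ f) (moebius σ⁻¹ x) (moebius σ⁻¹ x) t) (x : ℝ) :
    approxError Γ r (r - 1) f x₀ σ 1 (|σ 1 0| ^ (r - 2) / m ^ (r - 1)) x =
      periodIntegral m r f x₀ x := by
  have hm' : (0 : ℝ) < m := by exact_mod_cast hm
  have hmp : (((m : ℝ) ^ (r - 1) : ℝ) : ℂ) ≠ 0 := by
    exact_mod_cast (Real.rpow_pos_of_pos hm' _).ne'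
  have hΓ0 : ((Real.Gamma (r - 1) : ℝ) : ℂ) ≠ 0 := by
    exact_mod_cast (Real.Gamma_pos_of_pos (by linarith)).ne'
  have hI : Complex.I ^ ((r - 1 : ℝ) : ℂ) ≠ 0 := by
    rw [Complex.cpow_ne_zero_iff]
    exact Or.inl Complex.I_ne_zero
  have hIm : (Complex.I * m) ^ ((r - 1 : ℝ) : ℂ) =
      (((m : ℝ) ^ (r - 1) : ℝ) : ℂ) * Complex.I ^ ((r - 1 : ℝ) : ℂ) := by
    rw [mul_comm, ← Complex.ofReal_natCast, ofReal_mul_cpow hm' Complex.I_ne_zero,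
      Complex.ofReal_cpow hm'.le]
  rw [approxError, ← hmΓ, hv, periodIntegral, hIm, hF]
  -- At x = x₀ the second term vanishes since 0^(2α) = 0, whatever the value of `moebius` at its
  -- pole. The ray defining f_α(x₀) is then already the ray of the Eichler integral.
  rcases eq_or_ne x x₀ with rfl | hx
  · rw [integral_eichlerIntegrand_self, sub_self, abs_zero, Real.zero_rpow (by linarith)]
    generalize (∫ t in Set.Ioi (0 : ℝ), ((t ^ (r - 1 - 1) : ℝ) : ℂ) *
      f (ofComplex ((x₀ : ℝ) + t * Complex.I))) = J
    push_cast at hmp ⊢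
    field_simp
    ring
  · rw [hE x hx, hG, integral_eichlerIntegrand_self, integral_eichlerIntegrand_self, kernelFactor]
    generalize (∫ t in Set.Ioi (0 : ℝ), ((t ^ (r - 1 - 1) : ℝ) : ℂ) *
      f (ofComplex (x + t * Complex.I))) = J
    generalize (∫ t in Set.Ioi (0 : ℝ), ((t ^ (r - 1 - 1) : ℝ) : ℂ) *
      slash r σ f (ofComplex ((moebius σ⁻¹ x : ℝ) + t * Complex.I))) = J'
    push_cast at hmp ⊢
    field_simp
    ring

end FracModular

theorem corollary2p5 (Γ : Subgroup SL(2, ℤ)) (hΓ : Γ.FiniteIndex) (r : ℝ) (hr : 2 < r)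
    (mu : SL(2, ℤ) → ℂ) (f : UpperHalfPlane → ℂ) (hf : FracModular.IsCuspForm Γ r mu f)
    (x₀ : ℚ) (σ : SL(2, ℝ)) (hσ : FracModular.IsScalingMatrix Γ (x₀ : OnePoint ℚ) σ) :
    -- the series defining `f_α` and `f_α^σ`, `α = r - 1`, converge on the real line
    (∀ x : ℝ, ∃ s : ℂ, Filter.Tendsto
      (fun N : ℕ => FracModular.fracPartialSum
        (FracModular.cuspWidth Γ OnePoint.infty) f (r - 1) N x) Filter.atTop (nhds s)) ∧
    (∀ x : ℝ, ∃ s : ℂ, Filter.Tendsto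
      (fun N : ℕ => FracModular.fracPartialSum 1 (FracModular.slash r σ f) (r - 1) N x)
      Filter.atTop (nhds s)) ∧
    -- the integral converges absolutely
    (∀ x : ℝ, MeasureTheory.IntegrableOn (FracModular.eichlerIntegrand r f x₀ x)
      (Set.Ioi 0)) ∧
    ∃ A B : ℝ, A ≠ 0 ∧ 0 < B ∧
      (∀ x : ℝ, FracModular.approxError Γ r (r - 1) f x₀ σ A B x =
        FracModular.periodIntegral (FracModular.cuspWidth Γ OnePoint.infty) r f x₀ x) ∧
      ((∃ k : ℤ, r = k) → ∃ P : Polynomial ℂ, (P.natDegree : ℝ) ≤ r - 2 ∧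
        ∀ x : ℝ, FracModular.approxError Γ r (r - 1) f x₀ σ A B x = P.eval (x : ℂ)) := by
  open FracModular in
  have hr0 : 0 < r := by linarith
  obtain ⟨γ, h𝔞, hs⟩ := hσ.exists_isScaling
  obtain ⟨hγ, hx₀'⟩ := smul_infty_eq_coe h𝔞
  have hc : σ 1 0 < 0 := by
    refine hs.apply_one_zero_neg_or.resolve_right fun h => hγ ?_
    have h1 := h.1
    rw [hs.apply_zero, mul_eq_zero] at h1
    exact_mod_cast h1.resolve_right hs.sqrt_pos.ne'
  have hx₀ : (x₀ : ℝ) * σ 1 0 = σ 0 0 := by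
    rw [hs.apply_zero, hs.apply_zero, ← mul_assoc]
    congr 1
    exact_mod_cast hx₀'
  have hm : 0 < cuspWidth Γ OnePoint.infty := cuspWidth_pos Γ _
  have hm' : (0 : ℝ) < cuspWidth Γ OnePoint.infty := by exact_mod_cast hm
  obtain ⟨C, hC⟩ := hf.exists_bound hr0
  have hC' : ∀ z : UpperHalfPlane, ‖f z‖ ≤ C * z.im ^ (-(r / 2)) := fun z => by
    have := hC z
    rwa [← le_div_iff₀ (Real.rpow_pos_of_pos z.im_pos _), div_eq_mul_inv,
      ← Real.rpow_neg z.im_pos.le] at this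
  obtain ⟨C₁, hF⟩ := hf.isTwistedForm_dilate hr0 hC
  have hG := hf.isTwistedForm_slash hr0 hC h𝔞 hs
  have hG1 := hG
  rw [← dilate_one (slash r σ f)] at hG1
  -- Equivalent to r > 2: Hecke's exponent r/2 lies below the order α of the fractional integral.
  have hα : r / 2 < r - 1 := by linarith
  have sF := fun x => tendsto_fracPartialSum hm hF hα x
  have sG := fun x => tendsto_fracPartialSum one_pos hG1 hα x
  obtain ⟨D, δ, hδ, hdec⟩ := exists_norm_le_exp_of_dilate hm hF
  obtain ⟨D', δ', hδ', hdec'⟩ := hG.exists_norm_le_exp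
  obtain ⟨M, hM⟩ := exists_norm_vertical_le_exp hr0 hC' hδ hdec hc hδ' hdec' hx₀
  have hint := fun x : ℝ => integrableOn_eichlerIntegrand hr.le hf.holo hδ hM x
  have heq := approxError_eq_periodIntegral hr (x₀ := x₀) rfl hm
    (valueAtInfty_eq_zero (hf.cuspidal _ σ hσ)) (fun x => (sF x).2.limUnder_eq)
    (fun y => by simpa [fracIntegral] using (sG y).2.limUnder_eq)
    fun x hx => integral_eichler_eq hr hf.holo hC' hδ hdec hc hδ' hdec' hx₀ hx (hint x)
      (integrableOn_eichlerIntegrand_self (sF x).1)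
      (integrableOn_eichlerIntegrand_self (sG _).1)
  -- A is arbitrary because f(x₀) = 0, so 1 will do. B is |c|^(r-2) / m^(r-1) with c the lower left
  -- entry of σ: the first factor comes from the kernel, the second from the dilation by the width m
  -- of ∞.
  refine ⟨fun x => ⟨_, (sF x).2⟩, fun x => ⟨_, (sG x).2⟩, hint, 1, _, one_ne_zero, ?_, heq, ?_⟩
  · have : 0 < |σ 1 0| := abs_pos.2 hc.ne
    positivity
  · rintro ⟨k, hk⟩
    have hk2 : 2 < k := by
      rw [hk] at hr
      exact_mod_cast hr
    obtain ⟨n, hn⟩ := Int.eq_ofNat_of_zero_le (sub_nonneg.2 hk2.le)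
    have hrn : r = n + 2 := by
      rw [hk, ← sub_eq_iff_eq_add]
      exact_mod_cast hn
    obtain ⟨P, hdeg, hP⟩ := exists_polynomial_integral_eichlerIntegrand (f := f) (x₀ := x₀)
      (fun k => integrableOn_eichlerIntegrand (by simp) hf.holo hδ hM 0) n
    rw [← hrn] at hP
    refine ⟨Polynomial.C (((2 * Real.pi) ^ (r - 1) : ℝ) /
      ((Complex.I * cuspWidth Γ OnePoint.infty) ^ ((r - 1 : ℝ) : ℂ) *
        ((Real.Gamma (r - 1) : ℝ) : ℂ))) * P, ?_, fun x => ?_⟩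
    · have h1 : (((Polynomial.C (((2 * Real.pi) ^ (r - 1) : ℝ) /
        ((Complex.I * cuspWidth Γ OnePoint.infty) ^ ((r - 1 : ℝ) : ℂ) *
          ((Real.Gamma (r - 1) : ℝ) : ℂ))) * P).natDegree : ℕ) : ℝ) ≤ n := by
        exact_mod_cast (Polynomial.natDegree_C_mul_le _ _).trans hdeg
      linarith
    · rw [heq, periodIntegral, hP, Polynomial.eval_C_mul]

end
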